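/- Let $(M^5,g)$ be a connected, oriented smooth Riemannian $5$-manifold (the result holds for either orientation of a connected orientable $M$), and let $\nabla$ be a smooth metric connection on $TM$ whose torsion $T(X,Y,Z)=g(T(X,Y),Z)$, $T(X,Y)=\nabla_XY-\nabla_YX-[X,Y]$, is a $3$-form with $\nabla T=0$. Let $\sigma_T(X,Y,Z,V)=g(T(X,Y),T(Z,V))+g(T(Y,Z),T(X,V))+g(T(Z,X),T(Y,V))$, and assume that the $4$-form $\sigma_T$ is not identically zero. For real constants $\varrho,\lambda$, say that $T$ has the normal form with constants $(\varrho,\lambda)$ if at every point of $M$ there is a positively oriented orthonormal basis $e_1,\dots,e_5$ of the tangent space (an adapted basis) with $$T=-(\varrho\,e_{125}+\lambda\,e_{345}).$$ A metric almost contact structure is a triple $(\varphi,\xi,\eta)$ of a smooth $(1,1)$-tensor field, a smooth unit vector field and its metrically dual $1$-form with $\varphi^2=-\mathrm{Id}+\eta\otimes\xi$ and $g(\varphi V,\varphi W)=g(V,W)-\eta(V)\eta(W)$. Put $F(X,Y)=g(X,\varphi Y)$, $d\eta(X,Y)=X\eta(Y)-Y\eta(X)-\eta([X,Y])$ and $N(X,Y)=[\varphi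 X,\varphi Y]-\varphi[X,\varphi Y]-\varphi[\varphi X,Y]+\varphi^2[X,Y]+d\eta(X,Y)\,\xi$. The structure is quasi-Sasakian if $N=0$ and $dF=0$; it is $\alpha$-Sasakian, for a constant $\alpha\in\mathbb R$, if $N=0$ and $d\eta=\alpha F$; it is Sasakian if it is $2$-Sasakian in this sense. A characteristic connection of it is a metric connection with skew torsion for which $\varphi,\xi,\eta$ are parallel. Then $T$ has the normal form for some constants $\varrho,\lambda>0$. Moreover, for all real constants $\varrho,\lambda$ with $\varrho\neq-\lambda$ such that $T$ has the normal form with constants $(\varrho,\lambda)$, there is a metric almost contact structure $(\varphi,\xi,\eta)$ on $M$ with Reeb field $$\xi=\frac{1}{\varrho\lambda}\,{*\sigma_T}$$ and with $F=-(e_{12}+e_{34})$ in every adapted basis, such that: 1. $(\varphi,\xi,\eta)$ is quasi-Sasakian; 2. $\nabla$ is its characteristic connection, that is, $\nabla$ is a characteristic connection of $(\varphi,\xi,\eta)$, and every characteristic connection of $(\varphi,\xi,\eta)$ agrees with $\nabla$ on smooth vector fields; 3. $(\varphi,\xi,\eta)$ is $\alpha$-Sasakian for some constant $\alpha$ if and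 only if $\lambda=\varrho$; 4. if $\lambda=\varrho=2$, then $(\varphi,\xi,\eta)$ is Sasakian. -/

import Mathlib

open Bundle Manifold Module VectorField
open scoped ContDiff

noncomputable section

instance tangentSpace_finrank_fact {n : ℕ} {M : Type*} [TopologicalSpace M]
    [ChartedSpace (EuclideanSpace ℝ (Fin n)) M]
    [RiemannianBundle (fun x : M ↦ TangentSpace (𝓡 n) x)] (x : M) :
    Fact (finrank ℝ (TangentSpace (𝓡 n) x) = n) :=
  ⟨finrank_euclideanSpace_fin (𝕜 := ℝ) (n := n)⟩

instance tangentSpace_riemannian_one {n : ℕ} {M : Type*} [TopologicalSpace M]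
    [ChartedSpace (EuclideanSpace ℝ (Fin n)) M] [IsManifold (𝓡 n) ∞ M]
    [RiemannianBundle (fun x : M ↦ TangentSpace (𝓡 n) x)]
    [h : IsContMDiffRiemannianBundle (𝓡 n) ∞ (EuclideanSpace ℝ (Fin n))
      (fun x : M ↦ TangentSpace (𝓡 n) x)] :
    IsContMDiffRiemannianBundle (𝓡 n) 1 (EuclideanSpace ℝ (Fin n))
      (TangentSpace (𝓡 n) : M → Type _) :=
  h.of_le (by norm_cast)

/-- `X` is a smooth vector field on the `n`-manifold `M`. -/
def IsSmoothField {n : ℕ} {M : Type*} [TopologicalSpace M]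
    [ChartedSpace (EuclideanSpace ℝ (Fin n)) M] [IsManifold (𝓡 n) ∞ M]
    (X : Π x : M, TangentSpace (𝓡 n) x) : Prop :=
  ContMDiff (𝓡 n) (𝓡 n).tangent ∞ (fun x ↦ (⟨x, X x⟩ : TangentBundle (𝓡 n) M))

/-- The derivative `X f` of a real function `f` in the direction of a vector field `X`. -/
def dirDeriv {n : ℕ} {M : Type*} [TopologicalSpace M]
    [ChartedSpace (EuclideanSpace ℝ (Fin n)) M]
    (X : Π x : M, TangentSpace (𝓡 n) x) (f : M → ℝ) (x : M) : ℝ :=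
  mvfderiv (𝓡 n) f x (X x)

/-- Linear connections on the tangent bundle of the `n`-manifold `M`;
`cov Y x (X x)` is `(∇_X Y)(x)`. -/
abbrev LinearConnection (n : ℕ) (M : Type*) [TopologicalSpace M]
    [ChartedSpace (EuclideanSpace ℝ (Fin n)) M] [IsManifold (𝓡 n) ∞ M] :=
  CovariantDerivative (𝓡 n) (EuclideanSpace ℝ (Fin n)) (TangentSpace (𝓡 n) : M → Type _)

section Riemannian

variable {n : ℕ} {M : Type*} [TopologicalSpace M]
  [ChartedSpace (EuclideanSpace ℝ (Fin n)) M] [IsManifold (𝓡 n) ∞ M]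
  [RiemannianBundle (fun x : M ↦ TangentSpace (𝓡 n) x)]

/-- A field of orientations of the tangent spaces is an orientation of the Riemannian manifold
if the associated Riemannian volume form is smooth. -/
def IsSmoothOrientation (o : Π x : M, Orientation ℝ (TangentSpace (𝓡 n) x) (Fin n)) : Prop :=
  ∀ X : Fin n → Π x : M, TangentSpace (𝓡 n) x, (∀ i, IsSmoothField (X i)) →
    ContMDiff (𝓡 n) 𝓘(ℝ, ℝ) ∞ (fun x ↦ (o x).volumeForm (fun i ↦ X i x))

/-- The torsion as a `(3,0)`-tensor, `T(X,Y,Z) = g(T(X,Y),Z)`. -/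
def torsionTensor (cov : LinearConnection n M) (x : M) (X Y Z : TangentSpace (𝓡 n) x) : ℝ :=
  inner ℝ (cov.torsion x X Y) Z

/-- The torsion is skew, i.e. a `3`-form (antisymmetry in the first two arguments is automatic). -/
def HasSkewTorsion (cov : LinearConnection n M) : Prop :=
  ∀ (x : M) (X Y Z : TangentSpace (𝓡 n) x),
    torsionTensor cov x X Y Z = -torsionTensor cov x X Z Y

/-- `∇T = 0`. -/
def HasParallelTorsion (cov : LinearConnection n M) : Prop :=
  ∀ X Y Z W : Π x : M, TangentSpace (𝓡 n) x,
    IsSmoothField X → IsSmoothField Y → IsSmoothField Z → IsSmoothField W → ∀ x,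
      dirDeriv X (fun y ↦ torsionTensor cov y (Y y) (Z y) (W y)) x
        - torsionTensor cov x (cov Y x (X x)) (Z x) (W x)
        - torsionTensor cov x (Y x) (cov Z x (X x)) (W x)
        - torsionTensor cov x (Y x) (Z x) (cov W x (X x)) = 0

/-- The `4`-form `σ_T(X,Y,Z,V)`, the cyclic sum over `X, Y, Z` of `g(T(X,Y), T(Z,V))`. -/
def sigmaT (cov : LinearConnection n M) (x : M) (X Y Z V : TangentSpace (𝓡 n) x) : ℝ :=
  inner ℝ (cov.torsion x X Y) (cov.torsion x Z V)
    + inner ℝ (cov.torsion x Y Z) (cov.torsion x X V)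
    + inner ℝ (cov.torsion x Z X) (cov.torsion x Y V)

variable (n M) in
/-- Metric almost contact structures `(φ, ξ, η)` on the Riemannian manifold `M`. Smoothness of the
tensor fields `φ` and `η` is expressed through their action on smooth vector fields. -/
structure MetricAlmostContactStructure where
  φ : Π x : M, TangentSpace (𝓡 n) x →ₗ[ℝ] TangentSpace (𝓡 n) x
  ξ : Π x : M, TangentSpace (𝓡 n) x
  η : Π x : M, TangentSpace (𝓡 n) x →ₗ[ℝ] ℝ
  smooth_φ : ∀ X : Π x : M, TangentSpace (𝓡 n) x, IsSmoothField X →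
    IsSmoothField (fun x ↦ φ x (X x))
  smooth_ξ : IsSmoothField ξ
  smooth_η : ∀ X : Π x : M, TangentSpace (𝓡 n) x, IsSmoothField X →
    ContMDiff (𝓡 n) 𝓘(ℝ, ℝ) ∞ (fun x ↦ η x (X x))
  η_dual : ∀ (x : M) (V : TangentSpace (𝓡 n) x), η x V = inner ℝ (ξ x) V
  norm_ξ : ∀ x : M, inner ℝ (ξ x) (ξ x) = (1 : ℝ)
  φ_sq : ∀ (x : M) (V : TangentSpace (𝓡 n) x), φ x (φ x V) = -V + η x V • ξ x
  φ_compat : ∀ (x : M) (V W : TangentSpace (𝓡 n) x),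
    inner ℝ (φ x V) (φ x W) = inner ℝ V W - η x V * η x W

namespace MetricAlmostContactStructure

variable (S : MetricAlmostContactStructure n M)

/-- The fundamental form `F(X,Y) = g(X, φ Y)`. -/
def F (x : M) (X Y : TangentSpace (𝓡 n) x) : ℝ := inner ℝ X (S.φ x Y)

/-- The exterior derivative `dη(X,Y) = X η(Y) - Y η(X) - η([X,Y])`. -/
def dη (X Y : Π x : M, TangentSpace (𝓡 n) x) (x : M) : ℝ :=
  dirDeriv X (fun y ↦ S.η y (Y y)) x - dirDeriv Y (fun y ↦ S.η y (X y)) x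
    - S.η x (mlieBracket (𝓡 n) X Y x)

/-- The exterior derivative of the fundamental form. -/
def dF (X Y Z : Π x : M, TangentSpace (𝓡 n) x) (x : M) : ℝ :=
  dirDeriv X (fun y ↦ S.F y (Y y) (Z y)) x
    - dirDeriv Y (fun y ↦ S.F y (X y) (Z y)) x
    + dirDeriv Z (fun y ↦ S.F y (X y) (Y y)) x
    - S.F x (mlieBracket (𝓡 n) X Y x) (Z x)
    + S.F x (mlieBracket (𝓡 n) X Z x) (Y x)
    - S.F x (mlieBracket (𝓡 n) Y Z x) (X x)

/-- The Nijenhuis tensor of an almost contact structure,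
`N(X,Y) = [φX,φY] - φ[X,φY] - φ[φX,Y] + φ²[X,Y] + dη(X,Y) ξ`. -/
def N (X Y : Π x : M, TangentSpace (𝓡 n) x) (x : M) : TangentSpace (𝓡 n) x :=
  mlieBracket (𝓡 n) (fun y ↦ S.φ y (X y)) (fun y ↦ S.φ y (Y y)) x
    - S.φ x (mlieBracket (𝓡 n) X (fun y ↦ S.φ y (Y y)) x)
    - S.φ x (mlieBracket (𝓡 n) (fun y ↦ S.φ y (X y)) Y x)
    + S.φ x (S.φ x (mlieBracket (𝓡 n) X Y x))
    + S.dη X Y x • S.ξ x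

/-- `N = 0`. -/
def IsNormal : Prop :=
  ∀ X Y : Π x : M, TangentSpace (𝓡 n) x, IsSmoothField X → IsSmoothField Y →
    ∀ x, S.N X Y x = 0

/-- Quasi-Sasakian: `N = 0` and `dF = 0`. -/
def IsQuasiSasakian : Prop :=
  S.IsNormal ∧ ∀ X Y Z : Π x : M, TangentSpace (𝓡 n) x,
    IsSmoothField X → IsSmoothField Y → IsSmoothField Z → ∀ x, S.dF X Y Z x = 0

/-- `α`-Sasakian for the constant `α`: `N = 0` and `dη = α F`. -/
def IsAlphaSasakian (α : ℝ) : Prop :=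
  S.IsNormal ∧ ∀ X Y : Π x : M, TangentSpace (𝓡 n) x, IsSmoothField X → IsSmoothField Y →
    ∀ x, S.dη X Y x = α * S.F x (X x) (Y x)

/-- Sasakian: `α`-Sasakian with `α = 2`. -/
def IsSasakian : Prop := S.IsAlphaSasakian 2

/-- `∇` is a characteristic connection of the structure `(φ, ξ, η)`: a metric connection with
skew torsion for which `ξ`, `η` and `φ` are parallel. -/
structure IsCharacteristicConnection
    [IsContMDiffRiemannianBundle (𝓡 n) ∞ (EuclideanSpace ℝ (Fin n))
      (fun x : M ↦ TangentSpace (𝓡 n) x)]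
    (cov : LinearConnection n M) : Prop where
  metric : cov.IsMetricCompatible
  skew : HasSkewTorsion cov
  parallel_ξ : ∀ (x : M) (v : TangentSpace (𝓡 n) x), cov S.ξ x v = 0
  parallel_η : ∀ X Y : Π x : M, TangentSpace (𝓡 n) x, IsSmoothField X → IsSmoothField Y →
    ∀ x, dirDeriv X (fun y ↦ S.η y (Y y)) x - S.η x (cov Y x (X x)) = 0
  parallel_φ : ∀ X Y : Π x : M, TangentSpace (𝓡 n) x, IsSmoothField X → IsSmoothField Y →
    ∀ x, cov (fun y ↦ S.φ y (Y y)) x (X x) - S.φ x (cov Y x (X x)) = 0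

end MetricAlmostContactStructure

end Riemannian

/-- For an orthonormal basis `b` with dual basis `e_i` and indices `s`, the value
of the `k`-form `e_{s 0} ∧ ⋯ ∧ e_{s (k-1)}` on the vectors `v 0, …, v (k-1)`. -/
def frameForm {V : Type*} [NormedAddCommGroup V] [InnerProductSpace ℝ V] {m k : ℕ}
    (b : OrthonormalBasis (Fin m) ℝ V) (s : Fin k → Fin m) (v : Fin k → V) : ℝ :=
  Matrix.det (Matrix.of fun p q ↦ (inner ℝ (b (s p)) (v q) : ℝ))

section DimensionFive

variable {M : Type*} [TopologicalSpace M]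
  [ChartedSpace (EuclideanSpace ℝ (Fin 5)) M] [IsManifold (𝓡 5) ∞ M]
  [RiemannianBundle (fun x : M ↦ TangentSpace (𝓡 5) x)]

/-- The vector field (metrically, `1`-form) `*σ_T` on an oriented Riemannian `5`-manifold, computed
in a positively oriented orthonormal basis: `*e_{1234} = e_5`, and in general the form
`e_1 ∧ ⋯ ∧ ê_k ∧ ⋯ ∧ e_5` is sent to `(-1)^(5-k) e_k`. -/
def starSigmaT (o : Π x : M, Orientation ℝ (TangentSpace (𝓡 5) x) (Fin 5))
    (cov : LinearConnection 5 M) (x : M) : TangentSpace (𝓡 5) x :=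
  let e := (o x).finOrthonormalBasis (by norm_num) Fact.out
  ∑ k : Fin 5, ((-1 : ℝ) ^ (k : ℕ) *
    sigmaT cov x (e (k.succAbove 0)) (e (k.succAbove 1)) (e (k.succAbove 2))
      (e (k.succAbove 3))) • e k

/-- `(e_1, …, e_5)` is a positively oriented orthonormal basis of `T_x M` in which the torsion has
the normal form `T = -(ϱ e_{125} + λ e_{345})` (indices are shifted by one in the code). -/
def IsAdaptedBasis (o : Π x : M, Orientation ℝ (TangentSpace (𝓡 5) x) (Fin 5))
    (cov : LinearConnection 5 M) (rho lam : ℝ) (x : M)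
    (e : OrthonormalBasis (Fin 5) ℝ (TangentSpace (𝓡 5) x)) : Prop :=
  e.toBasis.orientation = o x ∧
    ∀ X Y Z : TangentSpace (𝓡 5) x, torsionTensor cov x X Y Z =
      -(rho * frameForm e ![0, 1, 4] ![X, Y, Z] + lam * frameForm e ![2, 3, 4] ![X, Y, Z])

/-- The torsion has the normal form with the constants `ϱ`, `λ` on all of `M`. -/
def HasTorsionNormalForm (o : Π x : M, Orientation ℝ (TangentSpace (𝓡 5) x) (Fin 5))
    (cov : LinearConnection 5 M) (rho lam : ℝ) : Prop :=
  ∀ x : M, ∃ e : OrthonormalBasis (Fin 5) ℝ (TangentSpace (𝓡 5) x),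
    IsAdaptedBasis o cov rho lam x e

end DimensionFive

end

/-! At a point, maximise `T(a,b,c)` over orthonormal triples. The first-order condition kills every
component with exactly two entries in a maximal triple, so besides `T(a,b,c)` only the contraction
of `T` with the two remaining directions survives. It is dual to a vector in the span of the triple.
Taking its direction as the last basis vector gives the normal form
(`IsSkewBilin.exists_normalFormIn`); sign changes and a swap of planes arrange `0 ≤ l ≤ r` and any
orientation. The constants may a priori vary from point to point. However, the squared norms of `T`
and `σ` are fixed multiples of `r² + l²` and `(r l)²`; both are constant because `∇T = 0` and `∇` is
metric, and together they determine an ordered nonnegative pair.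

In an adapted basis `σ = r l e₀₁₂₃`, so the normalised dual vector of `σ` is `ξ = e₄`. It spans the
kernel of the parallel form `σ` and has length one, hence is parallel (`cov_reeb_eq_zero`). The skew
endomorphism `A = T(ξ, ·)` has eigenvalues `±i r`, `±i l` and `0`, and `φ` is an odd cubic
polynomial in `A` sending `i r` and `i l` to `-i`. For `l = -r` oddness would make these two
conditions contradictory, hence the hypothesis `ϱ ≠ -λ`. A polynomial in `A` is smooth, parallel and
independent of the adapted basis (`cov_contactEndo`).

Once `φ`, `ξ`, `η` are parallel, `N`, `dF` and `dη` are algebraic in the torsion (`N_eq`, `dF_eq`,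
`dη_eq`), so the quasi-Sasakian condition and the criterion `dη = α F` are checked in one adapted
basis. Uniqueness holds because the difference of two characteristic connections is a three-form
which vanishes on `ξ` and changes sign whenever `φ` is moved from one slot to another; with three
slots this forces it to be zero (`eq_zero_of_skew_of_commute`). -/

noncomputable section

/-! ### Three-forms in dimension five and their four-form `σ` -/

section TorsionAlgebra

variable {V : Type*} [NormedAddCommGroup V] [InnerProductSpace ℝ V]

/-- A bilinear map is skew if the associated trilinear form is alternating. -/
structure IsSkewBilin (τ : V →L[ℝ] V →L[ℝ] V) : Prop where
  swap : ∀ X Y, τ X Y = -τ Y X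
  skew : ∀ X Y Z, (inner ℝ (τ X Y) Z : ℝ) = -inner ℝ (τ X Z) Y

/-- The normal form of a three-form in an orthonormal basis. -/
def NormalFormIn (τ : V →L[ℝ] V →L[ℝ] V) (r l : ℝ) (e : OrthonormalBasis (Fin 5) ℝ V) : Prop :=
  ∀ X Y Z : V, (inner ℝ (τ X Y) Z : ℝ) =
    -(r * frameForm e ![0, 1, 4] ![X, Y, Z] + l * frameForm e ![2, 3, 4] ![X, Y, Z])

theorem frameForm_three (e : OrthonormalBasis (Fin 5) ℝ V) (i j k : Fin 5) (X Y Z : V) :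
    frameForm e ![i, j, k] ![X, Y, Z] =
      inner ℝ (e i) X * (inner ℝ (e j) Y * inner ℝ (e k) Z - inner ℝ (e j) Z * inner ℝ (e k) Y)
      - inner ℝ (e i) Y * (inner ℝ (e j) X * inner ℝ (e k) Z - inner ℝ (e j) Z * inner ℝ (e k) X)
      + inner ℝ (e i) Z *
        (inner ℝ (e j) X * inner ℝ (e k) Y - inner ℝ (e j) Y * inner ℝ (e k) X) := by
  simp [frameForm, Matrix.det_fin_three]
  ring

theorem frameForm_two (e : OrthonormalBasis (Fin 5) ℝ V) (i j : Fin 5) (X Y : V) :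
    frameForm e ![i, j] ![X, Y] =
      inner ℝ (e i) X * inner ℝ (e j) Y - inner ℝ (e i) Y * inner ℝ (e j) X := by
  simp [frameForm, Matrix.det_fin_two]

theorem OrthonormalBasis.inner_eq_sum_five (e : OrthonormalBasis (Fin 5) ℝ V) (X Y : V) :
    (inner ℝ X Y : ℝ) = inner ℝ (e 0) X * inner ℝ (e 0) Y + inner ℝ (e 1) X * inner ℝ (e 1) Y
      + inner ℝ (e 2) X * inner ℝ (e 2) Y + inner ℝ (e 3) X * inner ℝ (e 3) Y
      + inner ℝ (e 4) X * inner ℝ (e 4) Y := by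
  rw [← e.sum_inner_mul_inner X Y, Fin.sum_univ_five]
  simp only [real_inner_comm X]

theorem OrthonormalBasis.ext_five (e : OrthonormalBasis (Fin 5) ℝ V) {X Y : V}
    (h0 : (inner ℝ (e 0) X : ℝ) = inner ℝ (e 0) Y) (h1 : (inner ℝ (e 1) X : ℝ) = inner ℝ (e 1) Y)
    (h2 : (inner ℝ (e 2) X : ℝ) = inner ℝ (e 2) Y) (h3 : (inner ℝ (e 3) X : ℝ) = inner ℝ (e 3) Y)
    (h4 : (inner ℝ (e 4) X : ℝ) = inner ℝ (e 4) Y) : X = Y := by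
  refine e.repr.injective (PiLp.ext fun i ↦ ?_)
  rw [e.repr_apply_apply, e.repr_apply_apply]
  fin_cases i <;> assumption

theorem OrthonormalBasis.inner_apply_ite (e : OrthonormalBasis (Fin 5) ℝ V) (i j : Fin 5) :
    (inner ℝ (e i) (e j) : ℝ) = if i = j then 1 else 0 :=
  orthonormal_iff_ite.mp e.orthonormal i j

/-- Only the values of `v` on `s` matter; the other entries are placeholders. -/
theorem exists_orthonormalBasis_five [FiniteDimensional ℝ V] (hV : finrank ℝ V = 5)
    {v : Fin 5 → V} (s : Set (Fin 5))
    (hv : ∀ i ∈ s, ∀ j ∈ s, (inner ℝ (v i) (v j) : ℝ) = if i = j then 1 else 0) :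
    ∃ b : OrthonormalBasis (Fin 5) ℝ V, ∀ i ∈ s, b i = v i := by
  refine Orthonormal.exists_orthonormalBasis_extension_of_card_eq (by simpa using hV) ?_
  rw [orthonormal_iff_ite]
  rintro ⟨i, hi⟩ ⟨j, hj⟩
  simpa [Set.domRestrict, Subtype.ext_iff] using hv i hi j hj

namespace NormalFormIn

variable {τ : V →L[ℝ] V →L[ℝ] V} {r l : ℝ} {e : OrthonormalBasis (Fin 5) ℝ V}

theorem coord_zero (h : NormalFormIn τ r l e) (X Y : V) : (inner ℝ (e 0) (τ X Y) : ℝ) =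
    -r * (inner ℝ (e 1) X * inner ℝ (e 4) Y - inner ℝ (e 4) X * inner ℝ (e 1) Y) := by
  rw [real_inner_comm, h, frameForm_three, frameForm_three]
  simp only [e.inner_apply_ite, Fin.isValue, Fin.reduceEq, if_true, if_false]
  ring

theorem coord_one (h : NormalFormIn τ r l e) (X Y : V) : (inner ℝ (e 1) (τ X Y) : ℝ) =
    -r * (inner ℝ (e 4) X * inner ℝ (e 0) Y - inner ℝ (e 0) X * inner ℝ (e 4) Y) := by
  rw [real_inner_comm, h, frameForm_three, frameForm_three]
  simp only [e.inner_apply_ite, Fin.isValue, Fin.reduceEq, if_true, if_false]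
  ring

theorem coord_two (h : NormalFormIn τ r l e) (X Y : V) : (inner ℝ (e 2) (τ X Y) : ℝ) =
    -l * (inner ℝ (e 3) X * inner ℝ (e 4) Y - inner ℝ (e 4) X * inner ℝ (e 3) Y) := by
  rw [real_inner_comm, h, frameForm_three, frameForm_three]
  simp only [e.inner_apply_ite, Fin.isValue, Fin.reduceEq, if_true, if_false]
  ring

theorem coord_three (h : NormalFormIn τ r l e) (X Y : V) : (inner ℝ (e 3) (τ X Y) : ℝ) =
    -l * (inner ℝ (e 4) X * inner ℝ (e 2) Y - inner ℝ (e 2) X * inner ℝ (e 4) Y) := by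
  rw [real_inner_comm, h, frameForm_three, frameForm_three]
  simp only [e.inner_apply_ite, Fin.isValue, Fin.reduceEq, if_true, if_false]
  ring

theorem coord_four (h : NormalFormIn τ r l e) (X Y : V) : (inner ℝ (e 4) (τ X Y) : ℝ) =
    -(r * (inner ℝ (e 0) X * inner ℝ (e 1) Y - inner ℝ (e 1) X * inner ℝ (e 0) Y)
      + l * (inner ℝ (e 2) X * inner ℝ (e 3) Y - inner ℝ (e 3) X * inner ℝ (e 2) Y)) := by
  rw [real_inner_comm, h, frameForm_three, frameForm_three]
  simp only [e.inner_apply_ite, Fin.isValue, Fin.reduceEq, if_true, if_false]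
  ring

end NormalFormIn

/-- The four-form `σ` of a bilinear map. -/
def sigmaForm (τ : V →L[ℝ] V →L[ℝ] V) (X Y Z W : V) : ℝ :=
  inner ℝ (τ X Y) (τ Z W) + inner ℝ (τ Y Z) (τ X W) + inner ℝ (τ Z X) (τ Y W)

/-- Laplace expansion along the first row, so that identities for `σ` become polynomial identities
in coordinates. -/
theorem frameForm_four (e : OrthonormalBasis (Fin 5) ℝ V) (X Y Z W : V) :
    frameForm e ![0, 1, 2, 3] ![X, Y, Z, W] =
      inner ℝ (e 0) X * frameForm e ![1, 2, 3] ![Y, Z, W]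
      - inner ℝ (e 0) Y * frameForm e ![1, 2, 3] ![X, Z, W]
      + inner ℝ (e 0) Z * frameForm e ![1, 2, 3] ![X, Y, W]
      - inner ℝ (e 0) W * frameForm e ![1, 2, 3] ![X, Y, Z] := by
  simp only [frameForm_three]
  simp [frameForm, Matrix.det_succ_row_zero, Fin.sum_univ_succ, Fin.succAbove]
  ring

/-- `σ` is half the sum of the squares `(e_i ⌟ T) ∧ (e_i ⌟ T)`. Every contraction is decomposable,
hence of square zero, except the one with `e 4`, whose square is `2 r l e₀₁₂₃`. -/
theorem NormalFormIn.sigmaForm_eq {τ : V →L[ℝ] V →L[ℝ] V} {r l : ℝ}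
    {e : OrthonormalBasis (Fin 5) ℝ V} (h : NormalFormIn τ r l e) (X Y Z W : V) :
    sigmaForm τ X Y Z W = r * l * frameForm e ![0, 1, 2, 3] ![X, Y, Z, W] := by
  simp only [sigmaForm, e.inner_eq_sum_five (τ _ _), h.coord_zero, h.coord_one, h.coord_two,
    h.coord_three, h.coord_four, frameForm_four, frameForm_three]
  ring

end TorsionAlgebra

/-! ### Existence of the normal form at a point -/

section NormalFormExistence

variable {V : Type*} [NormedAddCommGroup V] [InnerProductSpace ℝ V]

/-- Three pairwise orthogonal unit vectors. -/
def IsOrthonormalTriple (a b c : V) : Prop :=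
  (inner ℝ a a : ℝ) = 1 ∧ (inner ℝ b b : ℝ) = 1 ∧ (inner ℝ c c : ℝ) = 1 ∧
    (inner ℝ a b : ℝ) = 0 ∧ (inner ℝ a c : ℝ) = 0 ∧ (inner ℝ b c : ℝ) = 0

theorem norm_eq_one_of_inner_self {x : V} (hx : (inner ℝ x x : ℝ) = 1) : ‖x‖ = 1 := by
  rw [real_inner_self_eq_norm_sq] at hx
  nlinarith [norm_nonneg x]

theorem IsOrthonormalTriple.rotate {a b c : V} (h : IsOrthonormalTriple a b c) :
    IsOrthonormalTriple b c a := by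
  obtain ⟨h1, h2, h3, h4, h5, h6⟩ := h
  exact ⟨h2, h3, h1, h6, by rwa [real_inner_comm], by rwa [real_inner_comm]⟩

/-- A linear function on the unit circle that is maximal at `(1, 0)` has zero tangential derivative
there. The rational parametrisation of the circle reduces this to comparing a linear with a
quadratic term in `k`. -/
theorem eq_zero_of_forall_circle_le {m t : ℝ}
    (h : ∀ c s : ℝ, c ^ 2 + s ^ 2 = 1 → c * m + s * t ≤ m) : t = 0 := by
  have key : ∀ k : ℝ, k * t ≤ m * k ^ 2 := by
    intro k
    have hk : (1 + k ^ 2 : ℝ) ≠ 0 := by positivity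
    have := h ((1 - k ^ 2) / (1 + k ^ 2)) (2 * k / (1 + k ^ 2)) (by field_simp; ring)
    have h2 : (1 - k ^ 2) / (1 + k ^ 2) * m + 2 * k / (1 + k ^ 2) * t =
      ((1 - k ^ 2) * m + 2 * k * t) / (1 + k ^ 2) := by ring
    rw [h2, div_le_iff₀ (by positivity)] at this
    linarith
  by_contra ht
  have hm : (0 : ℝ) < |m| + 1 := by positivity
  -- A multiple of `t` small enough for the linear term to dominate.
  have := key (t / (|m| + 1))
  rw [div_mul_eq_mul_div, div_pow, mul_div_assoc', div_le_div_iff₀ hm (by positivity)] at this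
  have h3 : t ^ 2 * (|m| + 1 - m) ≤ 0 := by
    have : (|m| + 1) * (t ^ 2 * (|m| + 1 - m)) ≤ 0 := by nlinarith
    by_contra hcon
    push Not at hcon
    nlinarith [mul_pos hm hcon]
  have h4 : 0 < t ^ 2 := by positivity
  nlinarith [le_abs_self m]

variable {τ : V →L[ℝ] V →L[ℝ] V}

theorem IsSkewBilin.cyclic (h : IsSkewBilin τ) (X Y Z : V) :
    (inner ℝ (τ X Y) Z : ℝ) = inner ℝ (τ Y Z) X := by
  rw [h.swap X Y, inner_neg_left, h.skew Y X Z, neg_neg]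

theorem IsSkewBilin.exists_isMax [FiniteDimensional ℝ V] (hV : finrank ℝ V = 5) :
    ∃ a b c : V, IsOrthonormalTriple a b c ∧ ∀ a' b' c' : V, IsOrthonormalTriple a' b' c' →
      (inner ℝ (τ a' b') c' : ℝ) ≤ inner ℝ (τ a b) c := by
  let S : Set (V × V × V) := {p | IsOrthonormalTriple p.1 p.2.1 p.2.2}
  have hne : S.Nonempty := by
    have e : OrthonormalBasis (Fin 5) ℝ V := (stdOrthonormalBasis ℝ V).reindex (finCongr hV)
    exact ⟨(e 0, e 1, e 2), by simp [S, IsOrthonormalTriple, e.inner_apply_ite]⟩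
  have hclosed : IsClosed S := by
    simp only [S, IsOrthonormalTriple, Set.ofPred_and]
    refine (isClosed_eq (by fun_prop) (by fun_prop)).inter <|
      (isClosed_eq (by fun_prop) (by fun_prop)).inter <|
      (isClosed_eq (by fun_prop) (by fun_prop)).inter <|
      (isClosed_eq (by fun_prop) (by fun_prop)).inter <|
      (isClosed_eq (by fun_prop) (by fun_prop)).inter (isClosed_eq (by fun_prop) (by fun_prop))
  have hbdd : S ⊆ Metric.closedBall 0 1 := by
    rintro ⟨a, b, c⟩ ⟨h1, h2, h3, -⟩
    simp [Prod.norm_def, norm_eq_one_of_inner_self h1, norm_eq_one_of_inner_self h2,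
      norm_eq_one_of_inner_self h3]
  have hcomp : IsCompact S := (isCompact_closedBall _ _).of_isClosed_subset hclosed hbdd
  have hcont : ContinuousOn (fun p : V × V × V ↦ (inner ℝ (τ p.1 p.2.1) p.2.2 : ℝ)) S :=
    (((τ.continuous.comp continuous_fst).clm_apply (continuous_fst.comp continuous_snd)).inner
      (continuous_snd.comp continuous_snd)).continuousOn
  obtain ⟨⟨a, b, c⟩, hp, hmax⟩ := hcomp.exists_isMaxOn hne hcont
  exact ⟨a, b, c, hp, fun a' b' c' h' ↦ hmax (show (a', b', c') ∈ S from h')⟩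

/-- Rotating `a` towards `w` keeps the triple orthonormal, so the derivative of the maximised value
along this rotation vanishes. -/
theorem inner_eq_zero_of_isMax {a b c : V} (habc : IsOrthonormalTriple a b c)
    (hmax : ∀ a' b' c' : V, IsOrthonormalTriple a' b' c' →
      (inner ℝ (τ a' b') c' : ℝ) ≤ inner ℝ (τ a b) c) {w : V} (hw : (inner ℝ w w : ℝ) = 1)
    (hwa : (inner ℝ w a : ℝ) = 0) (hwb : (inner ℝ w b : ℝ) = 0) (hwc : (inner ℝ w c : ℝ) = 0) :
    (inner ℝ (τ w b) c : ℝ) = 0 := by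
  obtain ⟨h1, h2, h3, h4, h5, h6⟩ := habc
  refine eq_zero_of_forall_circle_le (m := inner ℝ (τ a b) c) fun k s hks ↦ ?_
  have := hmax (k • a + s • w) b c ⟨?_, h2, h3, ?_, ?_, h6⟩
  · simpa [inner_add_left, inner_smul_left] using this
  · rw [inner_add_left, inner_add_right, inner_add_right]
    simp only [inner_smul_left, inner_smul_right, h1, hw, hwa, real_inner_comm w a]
    simp only [conj_trivial]
    linear_combination hks
  · simp [inner_add_left, inner_smul_left, h4, hwb]
  · simp [inner_add_left, inner_smul_left, h5, hwc]

theorem IsSkewBilin.inner_self (h : IsSkewBilin τ) (X Y : V) : (inner ℝ (τ X Y) Y : ℝ) = 0 := by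
  have := h.skew X Y Y
  linarith

theorem IsSkewBilin.inner_self' (h : IsSkewBilin τ) (X Y : V) : (inner ℝ (τ X Y) X : ℝ) = 0 := by
  rw [h.swap, inner_neg_left, h.inner_self, neg_zero]

theorem eq_zero_of_alternating_of_sorted {ι : Type*} [LinearOrder ι] {f : ι → ι → ι → ℝ}
    (h₁ : ∀ i j k, f i j k = -f j i k) (h₂ : ∀ i j k, f i j k = -f i k j)
    (hz : ∀ i j k, i < j → j < k → f i j k = 0) (i j k : ι) : f i j k = 0 := by
  have self₁ : ∀ i k, f i i k = 0 := fun i k ↦ by linarith [h₁ i i k]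
  have self₂ : ∀ i k, f i k k = 0 := fun i k ↦ by linarith [h₂ i k k]
  have key : ∀ i j k, i < j → f i j k = 0 := by
    intro i j k hij
    rcases lt_trichotomy j k with hjk | rfl | hkj
    · exact hz i j k hij hjk
    · exact self₂ i j
    · rw [h₂]
      rcases lt_trichotomy i k with hik | rfl | hki
      · rw [hz i k j hik hkj, neg_zero]
      · rw [self₁, neg_zero]
      · rw [h₁, hz k i j hki hij, neg_zero, neg_zero]
  rcases lt_trichotomy i j with hij | rfl | hji
  · exact key i j k hij
  · exact self₁ i k
  · rw [h₁, key j i k hji, neg_zero]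

theorem inner_apply_eq_sum (τ : V →L[ℝ] V →L[ℝ] V) (e : OrthonormalBasis (Fin 5) ℝ V)
    (X Y Z : V) : (inner ℝ (τ X Y) Z : ℝ) = ∑ i, ∑ j, ∑ k, (inner ℝ (e i) X : ℝ) *
      (inner ℝ (e j) Y * (inner ℝ (e k) Z * inner ℝ (τ (e i) (e j)) (e k))) := by
  conv_lhs => rw [← e.sum_repr' X]
  simp only [map_sum, sum_apply, sum_inner, map_smul, smul_apply, inner_smul_left, conj_trivial]
  refine Finset.sum_congr rfl fun i _ ↦ ?_
  conv_lhs => rw [← e.sum_repr' Y]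
  simp only [map_sum, sum_inner, map_smul, inner_smul_left, conj_trivial, Finset.mul_sum]
  refine Finset.sum_congr rfl fun j _ ↦ ?_
  conv_lhs => rw [← e.sum_repr' Z]
  simp only [inner_sum, inner_smul_right, Finset.mul_sum]

/-- An alternating form with only two nonzero components is in normal form. -/
theorem IsSkewBilin.normalFormIn (h : IsSkewBilin τ) (e : OrthonormalBasis (Fin 5) ℝ V)
    (h012 : (inner ℝ (τ (e 0) (e 1)) (e 2) : ℝ) = 0)
    (h013 : (inner ℝ (τ (e 0) (e 1)) (e 3) : ℝ) = 0)
    (h023 : (inner ℝ (τ (e 0) (e 2)) (e 3) : ℝ) = 0)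
    (h024 : (inner ℝ (τ (e 0) (e 2)) (e 4) : ℝ) = 0)
    (h034 : (inner ℝ (τ (e 0) (e 3)) (e 4) : ℝ) = 0)
    (h123 : (inner ℝ (τ (e 1) (e 2)) (e 3) : ℝ) = 0)
    (h124 : (inner ℝ (τ (e 1) (e 2)) (e 4) : ℝ) = 0)
    (h134 : (inner ℝ (τ (e 1) (e 3)) (e 4) : ℝ) = 0) :
    NormalFormIn τ (-inner ℝ (τ (e 0) (e 1)) (e 4)) (-inner ℝ (τ (e 2) (e 3)) (e 4)) e := by
  -- The difference from the normal form is alternating, so only the ten increasing index triples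
  -- matter: eight vanish by hypothesis, two by the choice of constants.
  have key := eq_zero_of_alternating_of_sorted
    (f := fun i j k ↦ (inner ℝ (τ (e i) (e j)) (e k) : ℝ) -
      (inner ℝ (τ (e 0) (e 1)) (e 4) * frameForm e ![0, 1, 4] ![e i, e j, e k]
      + inner ℝ (τ (e 2) (e 3)) (e 4) * frameForm e ![2, 3, 4] ![e i, e j, e k]))
    (fun i j k ↦ by
      simp only [frameForm_three, h.swap (e i) (e j), inner_neg_left]
      ring)
    (fun i j k ↦ by
      simp only [frameForm_three, h.skew (e i) (e j) (e k)]
      ring)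
    (fun i j k hij hjk ↦ by
      fin_cases i <;> fin_cases j <;> fin_cases k <;>
        first
        | exact absurd hij (by decide)
        | exact absurd hjk (by decide)
        | simp [frameForm_three, e.inner_apply_ite, *])
  intro X Y Z
  simp only [sub_eq_zero] at key
  rw [inner_apply_eq_sum τ e]
  -- Without naming the two constants, `key` would keep rewriting its own right-hand side.
  generalize (inner ℝ (τ (e 0) (e 1)) (e 4) : ℝ) = a at *
  generalize (inner ℝ (τ (e 2) (e 3)) (e 4) : ℝ) = b at *
  simp only [key, frameForm_three, e.inner_apply_ite, Fin.sum_univ_five, Fin.isValue, Fin.reduceEq,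
    if_true, if_false]
  ring

theorem IsSkewBilin.exists_normalFormIn [FiniteDimensional ℝ V] (hV : finrank ℝ V = 5)
    (h : IsSkewBilin τ) :
    ∃ (r l : ℝ) (e : OrthonormalBasis (Fin 5) ℝ V), NormalFormIn τ r l e := by
  obtain ⟨a, b, c, habc, hmax⟩ := IsSkewBilin.exists_isMax (τ := τ) hV
  obtain ⟨f, hf⟩ := exists_orthonormalBasis_five hV (v := ![a, b, 0, 0, c]) {0, 1, 4} (by
    obtain ⟨h1, h2, h3, h4, h5, h6⟩ := habc
    have h4' := real_inner_comm a b ▸ h4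
    have h5' := real_inner_comm a c ▸ h5
    have h6' := real_inner_comm b c ▸ h6
    have n1 := norm_eq_one_of_inner_self h1
    have n2 := norm_eq_one_of_inner_self h2
    have n3 := norm_eq_one_of_inner_self h3
    simp [*])
  obtain ⟨f0, f1, f4⟩ : f 0 = a ∧ f 1 = b ∧ f 4 = c :=
    ⟨hf 0 (by simp), hf 1 (by simp), hf 4 (by simp)⟩
  subst f0 f1 f4
  -- Maximality of the triple is invariant under cyclic rotation, so each of its three vectors may
  -- be varied in turn.
  have hz : ∀ j : Fin 5, j ≠ 0 → j ≠ 1 → j ≠ 4 →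
      (inner ℝ (τ (f j) (f 1)) (f 4) : ℝ) = 0 ∧ (inner ℝ (τ (f j) (f 4)) (f 0) : ℝ) = 0 ∧
      (inner ℝ (τ (f j) (f 0)) (f 1) : ℝ) = 0 := by
    intro j h0 h1 h4
    refine ⟨inner_eq_zero_of_isMax habc hmax ?_ ?_ ?_ ?_,
      inner_eq_zero_of_isMax habc.rotate (fun a' b' c' h' ↦ ?_) ?_ ?_ ?_ ?_,
      inner_eq_zero_of_isMax habc.rotate.rotate (fun a' b' c' h' ↦ ?_) ?_ ?_ ?_ ?_⟩
    any_goals simp [f.inner_apply_ite, h0, h1, h4]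
    · rw [← h.cyclic (f 0)]; exact hmax _ _ _ h'
    · rw [h.cyclic (f 4)]; exact hmax _ _ _ h'
  -- The vectors `x`, `y` lie in the span of the maximal triple. Stating this for the span, not the
  -- triple, permits a new basis of the span later.
  have perp : ∀ j : Fin 5, j ≠ 0 → j ≠ 1 → j ≠ 4 → ∀ x y : V, (inner ℝ (f 2) x : ℝ) = 0 →
      (inner ℝ (f 3) x : ℝ) = 0 → (inner ℝ (f 2) y : ℝ) = 0 → (inner ℝ (f 3) y : ℝ) = 0 →
      (inner ℝ (τ (f j) x) y : ℝ) = 0 := by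
    intro j h0 h1 h4 x y hx2 hx3 hy2 hy3
    obtain ⟨z1, z2, z3⟩ := hz j h0 h1 h4
    have z1' := h.skew (f j) (f 4) (f 1)
    have z2' := h.skew (f j) (f 0) (f 4)
    have z3' := h.skew (f j) (f 1) (f 0)
    rw [z1, neg_zero] at z1'
    rw [z2, neg_zero] at z2'
    rw [z3, neg_zero] at z3'
    rw [inner_apply_eq_sum τ f, Finset.sum_eq_single j]
    · simp only [Fin.sum_univ_five, hx2, hx3, hy2, hy3, h.inner_self, z1, z2, z3, z1', z2', z3',
        mul_zero, zero_mul, add_zero]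
    · intro i _ hij
      simp [f.inner_apply_ite, hij]
    · simp
  -- The direction of `τ (f 2) (f 3)` becomes the last basis vector. If this vector is zero, any
  -- unit vector orthogonal to `f 2` and `f 3` will do.
  obtain ⟨u, hU, hu⟩ : ∃ u : V, τ (f 2) (f 3) = ‖τ (f 2) (f 3)‖ • u ∧
      (inner ℝ u u : ℝ) = 1 ∧ (inner ℝ (f 2) u : ℝ) = 0 ∧ (inner ℝ (f 3) u : ℝ) = 0 := by
    by_cases hU : τ (f 2) (f 3) = 0
    · exact ⟨f 4, by simp [hU], by simp [f.inner_apply_ite]⟩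
    · have hn : ‖τ (f 2) (f 3)‖ ≠ 0 := norm_ne_zero_iff.mpr hU
      refine ⟨‖τ (f 2) (f 3)‖⁻¹ • τ (f 2) (f 3), by rw [smul_inv_smul₀ hn], ?_, ?_, ?_⟩
      · rw [inner_smul_left, inner_smul_right, real_inner_self_eq_norm_sq, conj_trivial]
        field_simp
      · rw [inner_smul_right, real_inner_comm, h.inner_self', mul_zero]
      · rw [inner_smul_right, real_inner_comm, h.inner_self, mul_zero]
  obtain ⟨hu1, hu2, hu3⟩ := hu
  obtain ⟨e, he⟩ := exists_orthonormalBasis_five hV (v := ![0, 0, f 2, f 3, u]) {2, 3, 4} (by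
    have n1 := norm_eq_one_of_inner_self hu1
    have hu2' := real_inner_comm (f 2) u ▸ hu2
    have hu3' := real_inner_comm (f 3) u ▸ hu3
    simp [n1, hu2, hu3, hu2', hu3', f.inner_apply_ite])
  obtain ⟨e2, e3, e4⟩ : e 2 = f 2 ∧ e 3 = f 3 ∧ e 4 = u :=
    ⟨he 2 (by simp), he 3 (by simp), he 4 (by simp)⟩
  have hU' : ∀ i : Fin 5, i ≠ 4 → (inner ℝ (τ (e 2) (e 3)) (e i) : ℝ) = 0 := by
    intro i hi
    rw [e2, e3, hU, ← e4, inner_smul_left, e.inner_apply_ite, if_neg hi.symm, mul_zero]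
  rw [← e2, ← e3] at perp
  have perp2 : ∀ i k : Fin 5, i ≠ 2 → i ≠ 3 → k ≠ 2 → k ≠ 3 →
      (inner ℝ (τ (e 2) (e i)) (e k) : ℝ) = 0 := fun i k hi2 hi3 hk2 hk3 ↦ by
    rw [e2]
    exact perp 2 (by decide) (by decide) (by decide) _ _ (by simp [e.inner_apply_ite, hi2.symm])
      (by simp [e.inner_apply_ite, hi3.symm]) (by simp [e.inner_apply_ite, hk2.symm])
      (by simp [e.inner_apply_ite, hk3.symm])
  have perp3 : ∀ i k : Fin 5, i ≠ 2 → i ≠ 3 → k ≠ 2 → k ≠ 3 →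
      (inner ℝ (τ (e 3) (e i)) (e k) : ℝ) = 0 := fun i k hi2 hi3 hk2 hk3 ↦ by
    rw [e3]
    exact perp 3 (by decide) (by decide) (by decide) _ _ (by simp [e.inner_apply_ite, hi2.symm])
      (by simp [e.inner_apply_ite, hi3.symm]) (by simp [e.inner_apply_ite, hk2.symm])
      (by simp [e.inner_apply_ite, hk3.symm])
  refine ⟨_, _, e, h.normalFormIn e ?_ ?_ ?_ ?_ ?_ ?_ ?_ ?_⟩
  · rw [← h.cyclic]; exact perp2 0 1 (by decide) (by decide) (by decide) (by decide)
  · rw [← h.cyclic]; exact perp3 0 1 (by decide) (by decide) (by decide) (by decide)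
  · rw [h.cyclic]; exact hU' 0 (by decide)
  · rw [h.cyclic]; exact perp2 4 0 (by decide) (by decide) (by decide) (by decide)
  · rw [h.cyclic]; exact perp3 4 0 (by decide) (by decide) (by decide) (by decide)
  · rw [h.cyclic]; exact hU' 1 (by decide)
  · rw [h.cyclic]; exact perp2 4 1 (by decide) (by decide) (by decide) (by decide)
  · rw [h.cyclic]; exact perp3 4 1 (by decide) (by decide) (by decide) (by decide)

/-- The orthonormal basis obtained from another one by changing the signs of its vectors. -/
theorem OrthonormalBasis.exists_unitsSMul (e : OrthonormalBasis (Fin 5) ℝ V) (w : Fin 5 → ℝˣ)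
    (hw : ∀ i, (w i : ℝ) * w i = 1) : ∃ f : OrthonormalBasis (Fin 5) ℝ V,
      (∀ i, f i = (w i : ℝ) • e i) ∧ f.toBasis.orientation = (∏ i, w i)⁻¹ • e.toBasis.orientation := by
  have ho : Orthonormal ℝ (e.toBasis.unitsSMul w) := by
    rw [orthonormal_iff_ite]
    intro i j
    simp only [Basis.unitsSMul_apply, Units.smul_def, inner_smul_left, inner_smul_right,
      OrthonormalBasis.coe_toBasis, e.inner_apply_ite, conj_trivial]
    split_ifs with hij
    · subst hij; rw [mul_one, hw]
    · simp
  refine ⟨(e.toBasis.unitsSMul w).toOrthonormalBasis ho, fun i ↦ ?_, ?_⟩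
  · simp [Basis.unitsSMul_apply, Units.smul_def]
  · rw [Basis.toBasis_toOrthonormalBasis, Basis.orientation_unitsSMul]

/-- The constants of a normal form can be taken nonnegative and ordered, in any orientation. -/
theorem IsSkewBilin.exists_oriented_normalFormIn [FiniteDimensional ℝ V] (hV : finrank ℝ V = 5)
    (h : IsSkewBilin τ) (o : Orientation ℝ V (Fin 5)) :
    ∃ (r l : ℝ) (e : OrthonormalBasis (Fin 5) ℝ V), 0 ≤ l ∧ l ≤ r ∧
      e.toBasis.orientation = o ∧ NormalFormIn τ r l e := by
  obtain ⟨r, l, e, he⟩ := h.exists_normalFormIn hV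
  obtain ⟨r, l, e, hr, he⟩ : ∃ (r l : ℝ) (e : OrthonormalBasis (Fin 5) ℝ V),
      0 ≤ r ∧ NormalFormIn τ r l e := by
    rcases le_total 0 r with hr | hr
    · exact ⟨r, l, e, hr, he⟩
    -- The vector `e 0` occurs only in the first summand, so its reversal changes the sign of `r`
    -- alone; `e 2` does the same for `l` below.
    · obtain ⟨f, hf, -⟩ := e.exists_unitsSMul ![-1, 1, 1, 1, 1] (by simp [Fin.forall_fin_succ])
      refine ⟨-r, l, f, by linarith, fun X Y Z ↦ ?_⟩
      rw [he X Y Z]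
      simp only [frameForm_three, hf]
      simp
      ring
  obtain ⟨r, l, e, hr, hl, he⟩ : ∃ (r l : ℝ) (e : OrthonormalBasis (Fin 5) ℝ V),
      0 ≤ r ∧ 0 ≤ l ∧ NormalFormIn τ r l e := by
    rcases le_total 0 l with hl | hl
    · exact ⟨r, l, e, hr, hl, he⟩
    · obtain ⟨f, hf, -⟩ := e.exists_unitsSMul ![1, 1, -1, 1, 1] (by simp [Fin.forall_fin_succ])
      refine ⟨r, -l, f, hr, by linarith, fun X Y Z ↦ ?_⟩
      rw [he X Y Z]
      simp only [frameForm_three, hf]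
      simp
      ring
  obtain ⟨r, l, e, hl, hrl, he⟩ : ∃ (r l : ℝ) (e : OrthonormalBasis (Fin 5) ℝ V),
      0 ≤ l ∧ l ≤ r ∧ NormalFormIn τ r l e := by
    rcases le_total l r with hrl | hrl
    · exact ⟨r, l, e, hl, hrl, he⟩
    -- Interchanging the two planes interchanges `r` and `l`.
    · obtain ⟨f, hf⟩ := exists_orthonormalBasis_five hV (v := ![e 2, e 3, e 0, e 1, e 4]) Set.univ
        (by simp [Fin.forall_fin_succ, e.inner_apply_ite])
      refine ⟨l, r, f, hr, hrl, fun X Y Z ↦ ?_⟩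
      rw [he X Y Z]
      simp only [frameForm_three, hf _ (Set.mem_univ _)]
      simp
      ring
  rcases e.toBasis.orientation_eq_or_eq_neg o with ho | ho
  · exact ⟨r, l, e, hl, hrl, ho.symm, he⟩
  -- Three reversals flip the orientation, while each summand contains exactly two of the reversed
  -- vectors.
  · obtain ⟨f, hf, hfo⟩ := e.exists_unitsSMul ![-1, 1, -1, 1, -1] (by simp [Fin.forall_fin_succ])
    refine ⟨r, l, f, hl, hrl, ?_, fun X Y Z ↦ ?_⟩
    · rw [hfo, ho]
      simp [Fin.prod_univ_five]
    · rw [he X Y Z]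
      simp only [frameForm_three, hf]
      simp
      ring

end NormalFormExistence

/-! ### Invariants, the dual of `σ`, and the contact endomorphism -/

section NormalFormConsequences

variable {V : Type*} [NormedAddCommGroup V] [InnerProductSpace ℝ V]

/-- The almost contact endomorphism determined by a torsion in normal form: the odd polynomial in
`τ ξ` which takes the value `-i` at both of its eigenvalues `r i` and `l i`. -/
def contactEndo (τ : V →L[ℝ] V →L[ℝ] V) (r l : ℝ) (ξ : V) : V →ₗ[ℝ] V :=
  (-((r ^ 2 + r * l + l ^ 2) / (r * l * (r + l)))) • (τ ξ : V →ₗ[ℝ] V) +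
    (-(1 / (r * l * (r + l)))) •
      ((τ ξ : V →ₗ[ℝ] V) ∘ₗ (τ ξ : V →ₗ[ℝ] V) ∘ₗ (τ ξ : V →ₗ[ℝ] V))

theorem contactEndo_apply (τ : V →L[ℝ] V →L[ℝ] V) (r l : ℝ) (ξ X : V) :
    contactEndo τ r l ξ X = (-((r ^ 2 + r * l + l ^ 2) / (r * l * (r + l)))) • τ ξ X +
      (-(1 / (r * l * (r + l)))) • τ ξ (τ ξ (τ ξ X)) := rfl

/-- The vector dual to `σ` in the frame `v`. -/
def starSigmaIn (τ : V →L[ℝ] V →L[ℝ] V) (v : Fin 5 → V) : V :=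
  ∑ k : Fin 5, ((-1 : ℝ) ^ (k : ℕ) * sigmaForm τ (v (k.succAbove 0)) (v (k.succAbove 1))
    (v (k.succAbove 2)) (v (k.succAbove 3))) • v k

/-- Both sides are the squared norm of the vector representing `ℓ`. -/
theorem OrthonormalBasis.sum_sq_linearMap (e f : OrthonormalBasis (Fin 5) ℝ V) (ℓ : V →ₗ[ℝ] ℝ) :
    ∑ k, ℓ (f k) ^ 2 = ∑ k, ℓ (e k) ^ 2 := by
  have : FiniteDimensional ℝ V := e.toBasis.finiteDimensional_of_finite
  obtain ⟨w, hw⟩ : ∃ w : V, ∀ x, ℓ x = inner ℝ w x :=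
    ⟨(InnerProductSpace.toDual ℝ V).symm (LinearMap.toContinuousLinearMap ℓ), fun x ↦ by simp⟩
  simp only [hw, real_inner_comm _ w]
  have h1 := e.sum_sq_norm_inner_right w
  have h2 := f.sum_sq_norm_inner_right w
  simp only [Real.norm_eq_abs, sq_abs] at h1 h2
  rw [h1, h2]

/-- The basis is exchanged one slot at a time; skewness brings each slot in turn to the last place.
-/
theorem IsSkewBilin.sum_sq_inner {τ : V →L[ℝ] V →L[ℝ] V} (h : IsSkewBilin τ)
    (e f : OrthonormalBasis (Fin 5) ℝ V) :
    ∑ i, ∑ j, ∑ k, (inner ℝ (τ (f i) (f j)) (f k) : ℝ) ^ 2 =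
      ∑ i, ∑ j, ∑ k, (inner ℝ (τ (e i) (e j)) (e k) : ℝ) ^ 2 := by
  have key : ∀ w : V, ∑ k, (inner ℝ w (f k) : ℝ) ^ 2 = ∑ k, (inner ℝ w (e k) : ℝ) ^ 2 :=
    fun w ↦ OrthonormalBasis.sum_sq_linearMap e f (innerₗ V w)
  calc _ = ∑ i, ∑ j, ∑ k, (inner ℝ (τ (f i) (f j)) (e k) : ℝ) ^ 2 := by simp only [key]
    _ = ∑ i, ∑ k, ∑ j, (inner ℝ (τ (f i) (e k)) (f j) : ℝ) ^ 2 := by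
      refine Finset.sum_congr rfl fun i _ ↦ ?_
      rw [Finset.sum_comm]
      simp only [h.skew _ (f _) (e _), neg_sq]
    _ = ∑ i, ∑ k, ∑ j, (inner ℝ (τ (f i) (e k)) (e j) : ℝ) ^ 2 := by simp only [key]
    _ = ∑ k, ∑ j, ∑ i, (inner ℝ (τ (e k) (e j)) (f i) : ℝ) ^ 2 := by
      rw [Finset.sum_comm]
      refine Finset.sum_congr rfl fun k _ ↦ ?_
      rw [Finset.sum_comm]
      simp only [h.cyclic (f _) (e _) (e _)]
    _ = _ := by simp only [key]

/-- `σ` as a linear form in its first argument. -/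
def sigmaLin₁ (τ : V →L[ℝ] V →L[ℝ] V) (Y Z W : V) : V →ₗ[ℝ] ℝ where
  toFun X := sigmaForm τ X Y Z W
  map_add' a b := by simp [sigmaForm, inner_add_left, inner_add_right]; ring
  map_smul' a b := by simp [sigmaForm, inner_smul_left, inner_smul_right]; ring

/-- `σ` as a linear form in its second argument. -/
def sigmaLin₂ (τ : V →L[ℝ] V →L[ℝ] V) (X Z W : V) : V →ₗ[ℝ] ℝ where
  toFun Y := sigmaForm τ X Y Z W
  map_add' a b := by simp [sigmaForm, inner_add_left, inner_add_right]; ring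
  map_smul' a b := by simp [sigmaForm, inner_smul_left, inner_smul_right]; ring

/-- `σ` as a linear form in its third argument. -/
def sigmaLin₃ (τ : V →L[ℝ] V →L[ℝ] V) (X Y W : V) : V →ₗ[ℝ] ℝ where
  toFun Z := sigmaForm τ X Y Z W
  map_add' a b := by simp [sigmaForm, inner_add_left, inner_add_right]; ring
  map_smul' a b := by simp [sigmaForm, inner_smul_left, inner_smul_right]; ring

/-- `σ` as a linear form in its fourth argument. -/
def sigmaLin₄ (τ : V →L[ℝ] V →L[ℝ] V) (X Y Z : V) : V →ₗ[ℝ] ℝ where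
  toFun W := sigmaForm τ X Y Z W
  map_add' a b := by simp [sigmaForm, inner_add_right]; ring
  map_smul' a b := by simp [sigmaForm, inner_smul_right]; ring

/-- An infinitesimal rotation of an orthonormal basis does not change sums of squares. -/
theorem OrthonormalBasis.sum_mul_linearMap_eq_zero (e : OrthonormalBasis (Fin 5) ℝ V)
    {w : Fin 5 → V} (hw : ∀ i j, (inner ℝ (w i) (e j) : ℝ) + inner ℝ (e i) (w j) = 0)
    (ℓ : V →ₗ[ℝ] ℝ) : ∑ i, ℓ (e i) * ℓ (w i) = 0 := by
  have hw' : ∀ i, ℓ (w i) = ∑ j, (inner ℝ (e j) (w i) : ℝ) * ℓ (e j) := by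
    intro i
    conv_lhs => rw [← e.sum_repr' (w i)]
    simp
  have h1 : ∑ i, ℓ (e i) * ℓ (w i) =
      ∑ i, ∑ j, ℓ (e i) * ((inner ℝ (e j) (w i) : ℝ) * ℓ (e j)) := by
    simp only [hw', Finset.mul_sum]
  -- A skew matrix is paired with a symmetric one, so the sum equals its own negative.
  have h2 : ∑ i, ∑ j, ℓ (e i) * ((inner ℝ (e j) (w i) : ℝ) * ℓ (e j)) =
      -∑ i, ∑ j, ℓ (e i) * ((inner ℝ (e j) (w i) : ℝ) * ℓ (e j)) := by
    conv_lhs => rw [Finset.sum_comm]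
    simp only [← Finset.sum_neg_distrib]
    refine Finset.sum_congr rfl fun i _ ↦ Finset.sum_congr rfl fun j _ ↦ ?_
    have := hw i j
    rw [real_inner_comm] at this
    linear_combination ℓ (e i) * ℓ (e j) * this
  linarith

/-- Infinitesimal form of the basis independence of the norm: up to the factor two, this is the
derivative of the sum of squares when the basis moves with velocity `w`. -/
theorem IsSkewBilin.sum_mul_eq_zero {τ : V →L[ℝ] V →L[ℝ] V} (h : IsSkewBilin τ)
    (e : OrthonormalBasis (Fin 5) ℝ V) {w : Fin 5 → V}
    (hw : ∀ i j, (inner ℝ (w i) (e j) : ℝ) + inner ℝ (e i) (w j) = 0) :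
    ∑ i, ∑ j, ∑ k, (inner ℝ (τ (e i) (e j)) (e k) : ℝ) * (inner ℝ (τ (w i) (e j)) (e k)
      + inner ℝ (τ (e i) (w j)) (e k) + inner ℝ (τ (e i) (e j)) (w k)) = 0 := by
  have key : ∀ v : V, ∑ k, (inner ℝ v (e k) : ℝ) * inner ℝ v (w k) = 0 :=
    fun v ↦ OrthonormalBasis.sum_mul_linearMap_eq_zero e hw (innerₗ V v)
  have h3 : ∀ i j, ∑ k, (inner ℝ (τ (e i) (e j)) (e k) : ℝ) * inner ℝ (τ (e i) (e j)) (w k) = 0 :=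
    fun i j ↦ key _
  have h2 : ∀ i k, ∑ j, (inner ℝ (τ (e i) (e j)) (e k) : ℝ) * inner ℝ (τ (e i) (w j)) (e k) = 0 :=
    fun i k ↦ by simpa [h.skew _ _ (e k)] using key (τ (e i) (e k))
  have h1 : ∀ j k, ∑ i, (inner ℝ (τ (e i) (e j)) (e k) : ℝ) * inner ℝ (τ (w i) (e j)) (e k) = 0 :=
    fun j k ↦ by simpa only [h.cyclic _ (e j) (e k)] using key (τ (e j) (e k))
  simp only [mul_add, Finset.sum_add_distrib, h3, add_zero]
  have s2 : ∑ i, ∑ j, ∑ k, (inner ℝ (τ (e i) (e j)) (e k) : ℝ) * inner ℝ (τ (e i) (w j)) (e k)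
      = 0 := Finset.sum_eq_zero fun i _ ↦ by
    rw [Finset.sum_comm]; simp only [h2, Finset.sum_const_zero]
  have s1 : ∑ i, ∑ j, ∑ k, (inner ℝ (τ (e i) (e j)) (e k) : ℝ) * inner ℝ (τ (w i) (e j)) (e k)
      = 0 := by
    rw [Finset.sum_comm]
    refine Finset.sum_eq_zero fun j _ ↦ ?_
    rw [Finset.sum_comm]; simp only [h1, Finset.sum_const_zero]
  rw [s1, s2, add_zero]

theorem sum_sigmaForm_mul_eq_zero (τ : V →L[ℝ] V →L[ℝ] V)
    (e : OrthonormalBasis (Fin 5) ℝ V) {w : Fin 5 → V}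
    (hw : ∀ i j, (inner ℝ (w i) (e j) : ℝ) + inner ℝ (e i) (w j) = 0) :
    ∑ i, ∑ j, ∑ k, ∑ m, sigmaForm τ (e i) (e j) (e k) (e m) *
      (sigmaForm τ (w i) (e j) (e k) (e m) + sigmaForm τ (e i) (w j) (e k) (e m)
        + sigmaForm τ (e i) (e j) (w k) (e m) + sigmaForm τ (e i) (e j) (e k) (w m)) = 0 := by
  have key := OrthonormalBasis.sum_mul_linearMap_eq_zero e hw
  have h1 : ∀ j k m, ∑ i, sigmaForm τ (e i) (e j) (e k) (e m) *
    sigmaForm τ (w i) (e j) (e k) (e m) = 0 := fun _ _ _ ↦ key (sigmaLin₁ τ _ _ _)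
  have h2 : ∀ i k m, ∑ j, sigmaForm τ (e i) (e j) (e k) (e m) *
    sigmaForm τ (e i) (w j) (e k) (e m) = 0 := fun _ _ _ ↦ key (sigmaLin₂ τ _ _ _)
  have h3 : ∀ i j m, ∑ k, sigmaForm τ (e i) (e j) (e k) (e m) *
    sigmaForm τ (e i) (e j) (w k) (e m) = 0 := fun _ _ _ ↦ key (sigmaLin₃ τ _ _ _)
  have h4 : ∀ i j k, ∑ m, sigmaForm τ (e i) (e j) (e k) (e m) *
    sigmaForm τ (e i) (e j) (e k) (w m) = 0 := fun _ _ _ ↦ key (sigmaLin₄ τ _ _ _)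
  simp only [mul_add, Finset.sum_add_distrib, h4, add_zero]
  have s3 : ∑ i, ∑ j, ∑ k, ∑ m, sigmaForm τ (e i) (e j) (e k) (e m) *
      sigmaForm τ (e i) (e j) (w k) (e m) = 0 :=
    Finset.sum_eq_zero fun i _ ↦ Finset.sum_eq_zero fun j _ ↦ by
      rw [Finset.sum_comm]; simp only [h3, Finset.sum_const_zero]
  have s2 : ∑ i, ∑ j, ∑ k, ∑ m, sigmaForm τ (e i) (e j) (e k) (e m) *
      sigmaForm τ (e i) (w j) (e k) (e m) = 0 :=
    Finset.sum_eq_zero fun i _ ↦ by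
      rw [Finset.sum_comm]
      refine Finset.sum_eq_zero fun k _ ↦ ?_
      rw [Finset.sum_comm]; simp only [h2, Finset.sum_const_zero]
  have s1 : ∑ i, ∑ j, ∑ k, ∑ m, sigmaForm τ (e i) (e j) (e k) (e m) *
      sigmaForm τ (w i) (e j) (e k) (e m) = 0 := by
    rw [Finset.sum_comm]
    refine Finset.sum_eq_zero fun j _ ↦ ?_
    rw [Finset.sum_comm]
    refine Finset.sum_eq_zero fun k _ ↦ ?_
    rw [Finset.sum_comm]; simp only [h1, Finset.sum_const_zero]
  rw [s1, s2, s3, add_zero, add_zero]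

/-- Each exchange of basis takes place in the innermost sum, which is then moved outwards; this
leaves the order of summation reversed. -/
theorem sum_four_comm {ι : Type*} [Fintype ι] {W : Type*} {e f : ι → W} {s : W → W → W → W → ℝ}
    (k1 : ∀ Y Z W, ∑ i, s (f i) Y Z W = ∑ i, s (e i) Y Z W)
    (k2 : ∀ X Z W, ∑ i, s X (f i) Z W = ∑ i, s X (e i) Z W)
    (k3 : ∀ X Y W, ∑ i, s X Y (f i) W = ∑ i, s X Y (e i) W)
    (k4 : ∀ X Y Z, ∑ i, s X Y Z (f i) = ∑ i, s X Y Z (e i)) :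
    ∑ i, ∑ j, ∑ k, ∑ m, s (f i) (f j) (f k) (f m) =
      ∑ m, ∑ k, ∑ j, ∑ i, s (e i) (e j) (e k) (e m) := by
  calc _ = ∑ i, ∑ j, ∑ k, ∑ m, s (f i) (f j) (f k) (e m) := by simp only [k4]
    _ = ∑ i, ∑ j, ∑ m, ∑ k, s (f i) (f j) (f k) (e m) := Finset.sum_congr rfl fun i _ ↦
      Finset.sum_congr rfl fun j _ ↦ Finset.sum_comm
    _ = ∑ i, ∑ m, ∑ k, ∑ j, s (f i) (f j) (e k) (e m) := by
      simp only [k3]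
      exact Finset.sum_congr rfl fun i _ ↦ Finset.sum_comm.trans
        (Finset.sum_congr rfl fun j _ ↦ Finset.sum_comm)
    _ = ∑ m, ∑ k, ∑ j, ∑ i, s (f i) (e j) (e k) (e m) := by
      simp only [k2]
      exact Finset.sum_comm.trans (Finset.sum_congr rfl fun m _ ↦ Finset.sum_comm.trans
        (Finset.sum_congr rfl fun k _ ↦ Finset.sum_comm))
    _ = _ := by simp only [k1]

theorem sum_four_congr {ι : Type*} [Fintype ι] {W : Type*} {e f : ι → W} {s : W → W → W → W → ℝ}
    (k1 : ∀ Y Z W, ∑ i, s (f i) Y Z W = ∑ i, s (e i) Y Z W)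
    (k2 : ∀ X Z W, ∑ i, s X (f i) Z W = ∑ i, s X (e i) Z W)
    (k3 : ∀ X Y W, ∑ i, s X Y (f i) W = ∑ i, s X Y (e i) W)
    (k4 : ∀ X Y Z, ∑ i, s X Y Z (f i) = ∑ i, s X Y Z (e i)) :
    ∑ i, ∑ j, ∑ k, ∑ m, s (f i) (f j) (f k) (f m) =
      ∑ i, ∑ j, ∑ k, ∑ m, s (e i) (e j) (e k) (e m) :=
  -- A second application, with both families equal to `e`, undoes the reversal.
  (sum_four_comm k1 k2 k3 k4).trans (sum_four_comm (fun _ _ _ ↦ rfl) (fun _ _ _ ↦ rfl)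
    (fun _ _ _ ↦ rfl) (fun _ _ _ ↦ rfl)).symm

theorem sum_sq_sigmaForm (τ : V →L[ℝ] V →L[ℝ] V) (e f : OrthonormalBasis (Fin 5) ℝ V) :
    ∑ i, ∑ j, ∑ k, ∑ m, sigmaForm τ (f i) (f j) (f k) (f m) ^ 2 =
      ∑ i, ∑ j, ∑ k, ∑ m, sigmaForm τ (e i) (e j) (e k) (e m) ^ 2 := by
  have key := OrthonormalBasis.sum_sq_linearMap e f
  exact sum_four_congr (s := fun X Y Z W ↦ sigmaForm τ X Y Z W ^ 2)
    (fun _ _ _ ↦ key (sigmaLin₁ τ _ _ _)) (fun _ _ _ ↦ key (sigmaLin₂ τ _ _ _))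
    (fun _ _ _ ↦ key (sigmaLin₃ τ _ _ _)) (fun _ _ _ ↦ key (sigmaLin₄ τ _ _ _))

/-- The squared norm of the four-form `e₀ ∧ e₁ ∧ e₂ ∧ e₃`, summed over all index quadruples. -/
def fourFormNormSq : ℝ := ∑ i : Fin 5, ∑ j : Fin 5, ∑ k : Fin 5, ∑ m : Fin 5,
  (Matrix.det (Matrix.of fun p q ↦
    (if (![0, 1, 2, 3] p : Fin 5) = ![i, j, k, m] q then 1 else 0 : ℝ))) ^ 2

/-- Only positivity is needed, to cancel this factor. The index quadruple `(0, 1, 2, 3)` contributes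
the determinant of the identity. -/
theorem fourFormNormSq_pos : 0 < fourFormNormSq := by
  refine Finset.sum_pos' (fun i _ ↦ by positivity) ⟨0, Finset.mem_univ _, ?_⟩
  refine Finset.sum_pos' (fun i _ ↦ by positivity) ⟨1, Finset.mem_univ _, ?_⟩
  refine Finset.sum_pos' (fun i _ ↦ by positivity) ⟨2, Finset.mem_univ _, ?_⟩
  refine Finset.sum_pos' (fun i _ ↦ by positivity) ⟨3, Finset.mem_univ _, ?_⟩
  have : (Matrix.of fun p q : Fin 4 ↦
      (if (![0, 1, 2, 3] p : Fin 5) = ![0, 1, 2, 3] q then 1 else 0 : ℝ)) = 1 := by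
    ext p q
    fin_cases p <;> fin_cases q <;> simp
  rw [this]
  simp

namespace NormalFormIn

variable {τ : V →L[ℝ] V →L[ℝ] V} {r l : ℝ} {e : OrthonormalBasis (Fin 5) ℝ V}

/-- The factor six counts the orderings of the indices of each of the two basis three-forms. -/
theorem sum_sq_inner (h : NormalFormIn τ r l e) (hτ : IsSkewBilin τ)
    (f : OrthonormalBasis (Fin 5) ℝ V) :
    ∑ i, ∑ j, ∑ k, (inner ℝ (τ (f i) (f j)) (f k) : ℝ) ^ 2 = 6 * (r ^ 2 + l ^ 2) := by
  rw [hτ.sum_sq_inner e f]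
  simp only [h (e _) (e _) (e _), frameForm_three, e.inner_apply_ite, Fin.sum_univ_five,
    Fin.isValue, Fin.reduceEq, if_true, if_false]
  ring

theorem sum_sq_sigmaForm (h : NormalFormIn τ r l e) (f : OrthonormalBasis (Fin 5) ℝ V) :
    ∑ i, ∑ j, ∑ k, ∑ m, sigmaForm τ (f i) (f j) (f k) (f m) ^ 2 =
      (r * l) ^ 2 * fourFormNormSq := by
  rw [_root_.sum_sq_sigmaForm τ e f]
  simp only [h.sigmaForm_eq, mul_pow, ← Finset.mul_sum]
  rw [fourFormNormSq]
  refine congrArg _ <| Finset.sum_congr rfl fun i _ ↦ Finset.sum_congr rfl fun j _ ↦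
    Finset.sum_congr rfl fun k _ ↦ Finset.sum_congr rfl fun m _ ↦ ?_
  rw [frameForm]
  congr 2
  ext p q
  rw [Matrix.of_apply, Matrix.of_apply, ← e.inner_apply_ite]
  fin_cases q <;> rfl

/-- The coefficients are cofactors of the coordinate matrix along the row of `e 4`, and a matrix
times its adjugate is its determinant. Since `v` is an arbitrary family, smooth non-orthonormal
frames can be used to prove smoothness of the Reeb field. -/
theorem starSigmaIn_eq (h : NormalFormIn τ r l e) (v : Fin 5 → V) :
    starSigmaIn τ v = (r * l * e.toBasis.det v) • e 4 := by
  have hA : e.toBasis.toMatrix v = Matrix.of fun p q ↦ (inner ℝ (e p) (v q) : ℝ) := by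
    ext p q
    simp [Basis.toMatrix_apply, e.repr_apply_apply]
  set A : Matrix (Fin 5) (Fin 5) ℝ := Matrix.of fun p q ↦ (inner ℝ (e p) (v q) : ℝ) with hAdef
  have hs : ∀ k : Fin 5, (-1 : ℝ) ^ (k : ℕ) * sigmaForm τ (v (k.succAbove 0))
      (v (k.succAbove 1)) (v (k.succAbove 2)) (v (k.succAbove 3)) = r * l * A.adjugate k 4 := by
    intro k
    rw [h.sigmaForm_eq, Matrix.adjugate_fin_succ_eq_det_submatrix]
    have : frameForm e ![0, 1, 2, 3] ![v (k.succAbove 0), v (k.succAbove 1), v (k.succAbove 2),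
        v (k.succAbove 3)] = (A.submatrix (Fin.succAbove 4) k.succAbove).det := by
      rw [frameForm]
      congr 1
      ext p q
      fin_cases p <;> fin_cases q <;> rfl
    -- The cofactor sign is `(-1) ^ (4 + k)`, and the row index `4` is even.
    rw [this, pow_add]
    norm_num
    ring
  refine e.repr.injective (PiLp.ext fun p ↦ ?_)
  rw [e.repr_apply_apply, e.repr_apply_apply]
  simp only [starSigmaIn, hs, inner_sum, inner_smul_right, Basis.det_apply, hA, e.inner_apply_ite]
  have := congrFun (congrFun A.mul_adjugate p) 4
  rw [Matrix.mul_apply, Matrix.smul_apply, Matrix.one_apply, smul_eq_mul] at this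
  rw [mul_assoc, ← this, Finset.mul_sum]
  refine Finset.sum_congr rfl fun k _ ↦ ?_
  simp only [hAdef, Matrix.of_apply]
  ring

theorem endo_coord_zero (h : NormalFormIn τ r l e) (X : V) :
    (inner ℝ (e 0) (τ (e 4) X) : ℝ) = r * inner ℝ (e 1) X := by
  rw [h.coord_zero]
  simp only [e.inner_apply_ite, Fin.isValue, Fin.reduceEq, if_true, if_false]
  ring

theorem endo_coord_one (h : NormalFormIn τ r l e) (X : V) :
    (inner ℝ (e 1) (τ (e 4) X) : ℝ) = -r * inner ℝ (e 0) X := by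
  rw [h.coord_one]
  simp only [e.inner_apply_ite, Fin.isValue, Fin.reduceEq, if_true, if_false]
  ring

theorem endo_coord_two (h : NormalFormIn τ r l e) (X : V) :
    (inner ℝ (e 2) (τ (e 4) X) : ℝ) = l * inner ℝ (e 3) X := by
  rw [h.coord_two]
  simp only [e.inner_apply_ite, Fin.isValue, Fin.reduceEq, if_true, if_false]
  ring

theorem endo_coord_three (h : NormalFormIn τ r l e) (X : V) :
    (inner ℝ (e 3) (τ (e 4) X) : ℝ) = -l * inner ℝ (e 2) X := by
  rw [h.coord_three]
  simp only [e.inner_apply_ite, Fin.isValue, Fin.reduceEq, if_true, if_false]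
  ring

theorem endo_coord_four (h : NormalFormIn τ r l e) (X : V) :
    (inner ℝ (e 4) (τ (e 4) X) : ℝ) = 0 := by
  rw [h.coord_four]
  simp only [e.inner_apply_ite, Fin.isValue, Fin.reduceEq, if_false]
  ring

section Contact

/-- On the plane of `e 0`, `e 1` the square of `A = τ (e 4)` is `-r²`, so the cubic polynomial
reduces to `-l (r + l) / (r l (r + l))` times `A`, that is to `-A / r`. The other plane is symmetric
in `r` and `l`. -/
theorem contactEndo_coord_zero (h : NormalFormIn τ r l e) (hr : r ≠ 0) (hl : l ≠ 0)
    (hrl : r + l ≠ 0) (X : V) :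
    (inner ℝ (e 0) (contactEndo τ r l (e 4) X) : ℝ) = -inner ℝ (e 1) X := by
  rw [contactEndo_apply, inner_add_right, inner_smul_right, inner_smul_right]
  simp only [h.endo_coord_zero, h.endo_coord_one]
  field_simp
  ring

theorem contactEndo_coord_one (h : NormalFormIn τ r l e) (hr : r ≠ 0) (hl : l ≠ 0)
    (hrl : r + l ≠ 0) (X : V) :
    (inner ℝ (e 1) (contactEndo τ r l (e 4) X) : ℝ) = inner ℝ (e 0) X := by
  rw [contactEndo_apply, inner_add_right, inner_smul_right, inner_smul_right]
  simp only [h.endo_coord_zero, h.endo_coord_one]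
  field_simp
  ring

theorem contactEndo_coord_two (h : NormalFormIn τ r l e) (hr : r ≠ 0) (hl : l ≠ 0)
    (hrl : r + l ≠ 0) (X : V) :
    (inner ℝ (e 2) (contactEndo τ r l (e 4) X) : ℝ) = -inner ℝ (e 3) X := by
  rw [contactEndo_apply, inner_add_right, inner_smul_right, inner_smul_right]
  simp only [h.endo_coord_two, h.endo_coord_three]
  field_simp
  ring

theorem contactEndo_coord_three (h : NormalFormIn τ r l e) (hr : r ≠ 0) (hl : l ≠ 0)
    (hrl : r + l ≠ 0) (X : V) :
    (inner ℝ (e 3) (contactEndo τ r l (e 4) X) : ℝ) = inner ℝ (e 2) X := by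
  rw [contactEndo_apply, inner_add_right, inner_smul_right, inner_smul_right]
  simp only [h.endo_coord_two, h.endo_coord_three]
  field_simp
  ring

theorem contactEndo_coord_four (h : NormalFormIn τ r l e) (X : V) :
    (inner ℝ (e 4) (contactEndo τ r l (e 4) X) : ℝ) = 0 := by
  rw [contactEndo_apply, inner_add_right, inner_smul_right, inner_smul_right]
  simp only [h.endo_coord_four, mul_zero, add_zero]

theorem contactEndo_sq (h : NormalFormIn τ r l e) (hr : r ≠ 0) (hl : l ≠ 0) (hrl : r + l ≠ 0)
    (X : V) : contactEndo τ r l (e 4) (contactEndo τ r l (e 4) X) =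
      -X + (inner ℝ (e 4) X : ℝ) • e 4 := by
  apply e.ext_five <;>
  simp only [h.contactEndo_coord_zero hr hl hrl, h.contactEndo_coord_one hr hl hrl,
    h.contactEndo_coord_two hr hl hrl, h.contactEndo_coord_three hr hl hrl,
    h.contactEndo_coord_four, inner_add_right, inner_neg_right, inner_smul_right,
    e.inner_apply_ite, Fin.isValue, Fin.reduceEq, if_true, if_false] <;> ring

theorem inner_contactEndo_contactEndo (h : NormalFormIn τ r l e) (hr : r ≠ 0) (hl : l ≠ 0)
    (hrl : r + l ≠ 0) (X Y : V) :
    (inner ℝ (contactEndo τ r l (e 4) X) (contactEndo τ r l (e 4) Y) : ℝ) =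
      inner ℝ X Y - inner ℝ (e 4) X * inner ℝ (e 4) Y := by
  rw [e.inner_eq_sum_five, e.inner_eq_sum_five X]
  simp only [h.contactEndo_coord_zero hr hl hrl, h.contactEndo_coord_one hr hl hrl,
    h.contactEndo_coord_two hr hl hrl, h.contactEndo_coord_three hr hl hrl,
    h.contactEndo_coord_four]
  ring

theorem inner_contactEndo (h : NormalFormIn τ r l e) (hr : r ≠ 0) (hl : l ≠ 0)
    (hrl : r + l ≠ 0) (X Y : V) :
    (inner ℝ X (contactEndo τ r l (e 4) Y) : ℝ) =
      -(frameForm e ![0, 1] ![X, Y] + frameForm e ![2, 3] ![X, Y]) := by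
  rw [e.inner_eq_sum_five, frameForm_two, frameForm_two]
  simp only [h.contactEndo_coord_zero hr hl hrl, h.contactEndo_coord_one hr hl hrl,
    h.contactEndo_coord_two hr hl hrl, h.contactEndo_coord_three hr hl hrl,
    h.contactEndo_coord_four]
  ring

/-- The algebraic part of the vanishing of the Nijenhuis tensor. -/
theorem contactEndo_normal (h : NormalFormIn τ r l e) (hr : r ≠ 0) (hl : l ≠ 0)
    (hrl : r + l ≠ 0) (X Y : V) :
    τ X Y - τ (contactEndo τ r l (e 4) X) (contactEndo τ r l (e 4) Y)
      + contactEndo τ r l (e 4) (τ X (contactEndo τ r l (e 4) Y))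
      + contactEndo τ r l (e 4) (τ (contactEndo τ r l (e 4) X) Y) = 0 := by
  apply e.ext_five <;>
  simp only [inner_add_right, inner_sub_right, inner_zero_right,
    h.contactEndo_coord_zero hr hl hrl, h.contactEndo_coord_one hr hl hrl,
    h.contactEndo_coord_two hr hl hrl, h.contactEndo_coord_three hr hl hrl,
    h.contactEndo_coord_four, h.coord_zero, h.coord_one, h.coord_two, h.coord_three,
    h.coord_four] <;> ring

/-- The algebraic part of `dF = 0`. -/
theorem contactEndo_closed (h : NormalFormIn τ r l e) (hr : r ≠ 0) (hl : l ≠ 0)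
    (hrl : r + l ≠ 0) (X Y Z : V) :
    (inner ℝ (τ X Y) (contactEndo τ r l (e 4) Z) : ℝ)
      + inner ℝ (τ Y Z) (contactEndo τ r l (e 4) X)
      + inner ℝ (τ Z X) (contactEndo τ r l (e 4) Y) = 0 := by
  simp only [e.inner_eq_sum_five (τ _ _),
    h.contactEndo_coord_zero hr hl hrl, h.contactEndo_coord_one hr hl hrl,
    h.contactEndo_coord_two hr hl hrl, h.contactEndo_coord_three hr hl hrl,
    h.contactEndo_coord_four, h.coord_zero, h.coord_one, h.coord_two, h.coord_three,
    h.coord_four]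
  ring

/-- `ι_ξ T` is a multiple of the fundamental form exactly if the constants agree. -/
theorem inner_xi_eq_iff (h : NormalFormIn τ r l e) (hr : r ≠ 0) (hl : l ≠ 0)
    (hrl : r + l ≠ 0) (α : ℝ) :
    (∀ X Y, (inner ℝ (e 4) (τ X Y) : ℝ) = α * inner ℝ X (contactEndo τ r l (e 4) Y)) ↔
      r = α ∧ l = α := by
  constructor
  · intro H
    have h1 := H (e 0) (e 1)
    have h2 := H (e 2) (e 3)
    rw [h.inner_contactEndo hr hl hrl, frameForm_two, frameForm_two, h.coord_four] at h1 h2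
    simp only [e.inner_apply_ite, Fin.isValue, Fin.reduceEq, if_true, if_false] at h1 h2
    constructor <;> linarith
  · rintro ⟨rfl, rfl⟩ X Y
    rw [h.inner_contactEndo hr hl hrl, frameForm_two, frameForm_two, h.coord_four]
    ring

end Contact

theorem sigmaForm_xi (h : NormalFormIn τ r l e) (Y Z W : V) : sigmaForm τ (e 4) Y Z W = 0 := by
  rw [h.sigmaForm_eq, frameForm_four]
  simp only [frameForm_three, e.inner_apply_ite, Fin.isValue, Fin.reduceEq, if_false]
  ring

/-- The kernel of `σ` is spanned by `ξ`. -/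
theorem eq_smul_of_sigmaForm_eq_zero (h : NormalFormIn τ r l e) (hr : r ≠ 0) (hl : l ≠ 0) {X : V}
    (hX : ∀ Y Z W, sigmaForm τ X Y Z W = 0) : X = (inner ℝ (e 4) X : ℝ) • e 4 := by
  have hrl : r * l ≠ 0 := mul_ne_zero hr hl
  -- Each choice of three basis vectors isolates one of the first four coordinates of `X`.
  have h0 := hX (e 1) (e 2) (e 3)
  have h1 := hX (e 0) (e 2) (e 3)
  have h2 := hX (e 0) (e 1) (e 3)
  have h3 := hX (e 0) (e 1) (e 2)
  rw [h.sigmaForm_eq, mul_eq_zero, or_iff_right hrl, frameForm_four] at h0 h1 h2 h3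
  simp only [frameForm_three, e.inner_apply_ite, Fin.isValue, Fin.reduceEq, if_true, if_false]
    at h0 h1 h2 h3
  apply e.ext_five <;> simp only [inner_smul_right, e.inner_apply_ite, Fin.isValue, Fin.reduceEq,
    if_true, if_false] <;> linarith

end NormalFormIn

end NormalFormConsequences

/-! ### Smooth fields, cut-offs and the Leibniz rule for the torsion -/

section Fields

variable {n : ℕ} {M : Type*} [TopologicalSpace M]
  [ChartedSpace (EuclideanSpace ℝ (Fin n)) M] [IsManifold (𝓡 n) ∞ M]

namespace IsSmoothField

variable {X Y : Π x : M, TangentSpace (𝓡 n) x}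

theorem mdifferentiableAt (hX : IsSmoothField X) (x : M) :
    MDifferentiableAt (𝓡 n) (𝓡 n).tangent (fun y ↦ (⟨y, X y⟩ : TangentBundle (𝓡 n) M)) x :=
  (hX x).mdifferentiableAt (by simp)

theorem add (hX : IsSmoothField X) (hY : IsSmoothField Y) : IsSmoothField (fun x ↦ X x + Y x) :=
  ContMDiff.add_section hX hY

theorem sub (hX : IsSmoothField X) (hY : IsSmoothField Y) : IsSmoothField (fun x ↦ X x - Y x) :=
  ContMDiff.sub_section hX hY

theorem const_smul (c : ℝ) (hX : IsSmoothField X) : IsSmoothField (fun x ↦ c • X x) :=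
  ContMDiff.const_smul_section hX

theorem smul {f : M → ℝ} (hf : ContMDiff (𝓡 n) 𝓘(ℝ, ℝ) ∞ f) (hX : IsSmoothField X) :
    IsSmoothField (fun x ↦ f x • X x) :=
  ContMDiff.smul_section hf hX

theorem mlieBracket (hX : IsSmoothField X) (hY : IsSmoothField Y) :
    IsSmoothField (fun x ↦ mlieBracket (𝓡 n) X Y x) :=
  haveI : IsManifold (𝓡 n) (minSmoothness ℝ 2) M := by
    rw [minSmoothness_of_isRCLikeNormedField]; infer_instance
  haveI : IsManifold (𝓡 n) ((⊤ : ℕ∞) + 1) M := by assumption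
  ContDiff.mlieBracket_vectorField (m := ⊤) (n := ⊤) hX hY (by simp)

theorem cov {cov : LinearConnection n M} (hcov : cov.ContMDiffCovariantDerivative ∞)
    (hX : IsSmoothField X) (hY : IsSmoothField Y) : IsSmoothField (fun x ↦ cov Y x (X x)) := by
  have h := hcov.contMDiff.contMDiff (σ := Y) (ContMDiff.contMDiffOn hY)
  rw [contMDiffOn_univ] at h
  exact ContMDiff.clm_bundle_apply (b := fun x ↦ x) h hX

theorem torsion {cov : LinearConnection n M} (hcov : cov.ContMDiffCovariantDerivative ∞)
    (hX : IsSmoothField X) (hY : IsSmoothField Y) :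
    IsSmoothField (fun x ↦ cov.torsion x (X x) (Y x)) := by
  have : (fun x ↦ cov.torsion x (X x) (Y x)) =
      fun x ↦ cov Y x (X x) - cov X x (Y x) - VectorField.mlieBracket (𝓡 n) X Y x := by
    funext x
    exact cov.torsion_apply (hX.mdifferentiableAt x) (hY.mdifferentiableAt x)
  rw [this]
  exact ((hX.cov hcov hY).sub (hY.cov hcov hX)).sub (hX.mlieBracket hY)

end IsSmoothField

/-- A bump function supported in `u` and equal to one near `x` extends the field by zero. This makes
local fields available where globally smooth ones are required. -/
theorem exists_smoothField_eventuallyEq [T2Space M] {X : Π x : M, TangentSpace (𝓡 n) x}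
    {u : Set M} (hu : IsOpen u) {x : M} (hx : x ∈ u)
    (hX : ContMDiffOn (𝓡 n) (𝓡 n).tangent ∞ (fun y ↦ (⟨y, X y⟩ : TangentBundle (𝓡 n) M)) u) :
    ∃ X' : Π x : M, TangentSpace (𝓡 n) x, IsSmoothField X' ∧ ∀ᶠ y in nhds x, X' y = X y := by
  obtain ⟨f, hfu, hf⟩ := (SmoothBumpFunction.nhds_basis_tsupport (I := 𝓡 n) x).mem_iff.mp
    (hu.mem_nhds hx)
  refine ⟨fun y ↦ f y • X y,
    ContMDiffOn.smul_section_of_tsupport f.contMDiff.contMDiffOn hu hf hX, ?_⟩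
  filter_upwards [f.eventuallyEq_one] with y hy
  rw [hy, Pi.one_apply, one_smul]

/-- Passes from identities for smooth fields to pointwise identities of tensors. The field has
constant coefficients in a local frame, before cutting off. -/
theorem exists_smoothField_apply_eq [T2Space M] (x : M) (v : TangentSpace (𝓡 n) x) :
    ∃ X : Π x : M, TangentSpace (𝓡 n) x, IsSmoothField X ∧ X x = v := by
  let e := trivializationAt (EuclideanSpace ℝ (Fin n)) (TangentSpace (𝓡 n) : M → Type _) x
  let b := (EuclideanSpace.basisFun (Fin n) ℝ).toBasis
  have hx : x ∈ e.baseSet := FiberBundle.mem_baseSet_trivializationAt _ _ x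
  have hsmooth : ContMDiffOn (𝓡 n) (𝓡 n).tangent ∞ (fun y ↦ (⟨y, ∑ i, (e.basisAt b hx).repr v i •
      e.localFrame b i y⟩ : TangentBundle (𝓡 n) M)) e.baseSet :=
    ContMDiffOn.sum_section fun i _ ↦
      ContMDiffOn.const_smul_section (e.contMDiffOn_localFrame_baseSet ∞ b i)
  obtain ⟨X, hX, hXe⟩ := exists_smoothField_eventuallyEq e.open_baseSet hx hsmooth
  refine ⟨X, hX, ?_⟩
  rw [hXe.self_of_nhds]
  simp only [e.localFrame_apply_of_mem_baseSet b hx]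
  exact (e.basisAt b hx).sum_repr v

omit [IsManifold (𝓡 n) ∞ M] in
theorem dirDeriv_congr (X : Π x : M, TangentSpace (𝓡 n) x) {f g : M → ℝ} {x : M}
    (h : f =ᶠ[nhds x] g) : dirDeriv X f x = dirDeriv X g x := by
  simp only [dirDeriv, mvfderiv, h.mfderiv_eq]
  rfl

variable [RiemannianBundle (fun x : M ↦ TangentSpace (𝓡 n) x)]
    [IsContMDiffRiemannianBundle (𝓡 n) ∞ (EuclideanSpace ℝ (Fin n))
      (fun x : M ↦ TangentSpace (𝓡 n) x)]

theorem IsSmoothField.inner {X Y : Π x : M, TangentSpace (𝓡 n) x} (hX : IsSmoothField X)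
    (hY : IsSmoothField Y) : ContMDiff (𝓡 n) 𝓘(ℝ, ℝ) ∞ (fun x ↦ (inner ℝ (X x) (Y x) : ℝ)) :=
  ContMDiff.inner_bundle (IB := 𝓡 n) (b := fun x ↦ x) hX hY

theorem dirDeriv_inner {cov : LinearConnection n M} (hmetric : cov.IsMetricCompatible)
    (X : Π x : M, TangentSpace (𝓡 n) x) {Y Z : Π x : M, TangentSpace (𝓡 n) x}
    (hY : IsSmoothField Y) (hZ : IsSmoothField Z) (x : M) :
    dirDeriv X (fun y ↦ (inner ℝ (Y y) (Z y) : ℝ)) x =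
      inner ℝ (cov Y x (X x)) (Z x) + inner ℝ (Y x) (cov Z x (X x)) :=
  hmetric.mvfderiv_inner_eq X (hY.mdifferentiableAt x) (hZ.mdifferentiableAt x)

/-- Metric compatibility strips off the test field `W` from the scalar condition `∇T = 0`. -/
theorem cov_torsion [T2Space M] {cov : LinearConnection n M}
    (hcov : cov.ContMDiffCovariantDerivative ∞) (hmetric : cov.IsMetricCompatible) (hparallel : HasParallelTorsion cov)
    {X Y Z : Π x : M, TangentSpace (𝓡 n) x} (hX : IsSmoothField X)
    (hY : IsSmoothField Y) (hZ : IsSmoothField Z) (x : M) :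
    cov (fun y ↦ cov.torsion y (Y y) (Z y)) x (X x) =
      cov.torsion x (cov Y x (X x)) (Z x) + cov.torsion x (Y x) (cov Z x (X x)) := by
  refine ext_inner_right ℝ fun w ↦ ?_
  obtain ⟨W, hW, rfl⟩ := exists_smoothField_apply_eq x w
  have h1 := hparallel X Y Z W hX hY hZ hW x
  have h2 := dirDeriv_inner hmetric X (hY.torsion hcov hZ) hW x
  simp only [torsionTensor] at h1
  rw [h2] at h1
  rw [inner_add_left]
  linarith

omit [IsContMDiffRiemannianBundle (𝓡 n) ∞ (EuclideanSpace ℝ (Fin n))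
      (fun x : M ↦ TangentSpace (𝓡 n) x)] in
theorem isSkewBilin_torsion {cov : LinearConnection n M} (hskew : HasSkewTorsion cov) (x : M) :
    IsSkewBilin (cov.torsion x) :=
  ⟨cov.torsion_antisymm, hskew x⟩

end Fields

/-! ### Functions with zero derivative on a connected manifold -/

section Constancy

variable {n : ℕ} {M : Type*} [TopologicalSpace M]
  [ChartedSpace (EuclideanSpace ℝ (Fin n)) M] [IsManifold (𝓡 n) ∞ M]

theorem isLocallyConstant_of_hasMFDerivAt_zero {f : M → ℝ}
    (h : ∀ x, HasMFDerivAt (𝓡 n) 𝓘(ℝ, ℝ) f x 0) : IsLocallyConstant f := by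
  rw [IsLocallyConstant.iff_eventually_eq]
  intro x
  have hopen : IsOpen (extChartAt (𝓡 n) x).target := isOpen_extChartAt_target x
  obtain ⟨ε, hε, hball⟩ := Metric.isOpen_iff.mp hopen _ (mem_extChartAt_target x)
  have hg : ∀ y ∈ Metric.ball (extChartAt (𝓡 n) x x) ε,
      HasFDerivAt (f ∘ (extChartAt (𝓡 n) x).symm) (0 : EuclideanSpace ℝ (Fin n) →L[ℝ] ℝ) y := by
    intro y hy
    have h1 := ((contMDiffOn_extChartAt_symm (n := ∞) (I := 𝓡 n) x).contMDiffAt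
      (hopen.mem_nhds (hball hy))).mdifferentiableAt (by simp)
    have h2 := (h ((extChartAt (𝓡 n) x).symm y)).comp y h1.hasMFDerivAt
    rw [hasMFDerivAt_iff_hasFDerivAt] at h2
    exact h2.congr_fderiv (ContinuousLinearMap.ext fun v ↦ rfl)
  have hball' : (extChartAt (𝓡 n) x) ⁻¹' (Metric.ball (extChartAt (𝓡 n) x x) ε) ∈ nhds x :=
    (continuousAt_extChartAt x).preimage_mem_nhds (Metric.ball_mem_nhds _ hε)
  filter_upwards [hball', extChartAt_source_mem_nhds (I := 𝓡 n) x] with y hy hys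
  have h3 := Metric.isOpen_ball.is_const_of_fderiv_eq_zero
    (convex_ball (extChartAt (𝓡 n) x x) ε).isPreconnected
    (fun y hy ↦ (hg y hy).differentiableAt.differentiableWithinAt)
    (fun y hy ↦ (hg y hy).fderiv) hy (Metric.mem_ball_self hε)
  rwa [Function.comp_apply, Function.comp_apply, (extChartAt (𝓡 n) x).left_inv hys,
    extChartAt_to_inv] at h3

theorem eq_of_dirDeriv_eq_zero [ConnectedSpace M] {f : M → ℝ}
    (hf : ∀ x, MDifferentiableAt (𝓡 n) 𝓘(ℝ, ℝ) f x)
    (h : ∀ x (v : TangentSpace (𝓡 n) x), mvfderiv (𝓡 n) f x v = 0) (x y : M) : f x = f y := by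
  refine (isLocallyConstant_of_hasMFDerivAt_zero (n := n) fun z ↦ ?_).apply_eq_of_preconnectedSpace x y
  have := (hf z).hasMFDerivAt
  convert this using 1
  ext v
  exact (h z v).symm

end Constancy

/-! ### Local smooth orthonormal frames -/

section OrthonormalFrame

variable {n : ℕ} {M : Type*} [TopologicalSpace M] [T2Space M]
  [ChartedSpace (EuclideanSpace ℝ (Fin n)) M] [IsManifold (𝓡 n) ∞ M]
  [RiemannianBundle (fun x : M ↦ TangentSpace (𝓡 n) x)]
  [IsContMDiffRiemannianBundle (𝓡 n) ∞ (EuclideanSpace ℝ (Fin n))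
      (fun x : M ↦ TangentSpace (𝓡 n) x)]

open InnerProductSpace in
-- Gram–Schmidt applied to a local frame, then a cut-off: the fields are smooth everywhere but
-- orthonormal only near `x`.
theorem exists_smooth_orthonormal_frame (x : M) :
    ∃ E : Fin n → Π x : M, TangentSpace (𝓡 n) x, (∀ i, IsSmoothField (E i)) ∧
      ∀ᶠ y in nhds x, Orthonormal ℝ (fun i ↦ E i y) := by
  let e := trivializationAt (EuclideanSpace ℝ (Fin n)) (TangentSpace (𝓡 n) : M → Type _) x
  let b := (EuclideanSpace.basisFun (Fin n) ℝ).toBasis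
  have hx : x ∈ e.baseSet := FiberBundle.mem_baseSet_trivializationAt _ _ x
  have hli : ∀ y ∈ e.baseSet, LinearIndependent ℝ (fun i ↦ e.localFrame b i y) :=
    fun y hy ↦ (e.isLocalFrameOn_localFrame_baseSet (𝓡 n) ∞ b).linearIndependent hy
  let G : Fin n → Π y : M, TangentSpace (𝓡 n) y :=
    fun i y ↦ gramSchmidt ℝ (fun i ↦ e.localFrame b i y) i
  have hG0 : ∀ i, ∀ y ∈ e.baseSet, G i y ≠ 0 := fun i y hy ↦ gramSchmidt_ne_zero i (hli y hy)
  have hsq : ∀ i (y : M), ‖G i y‖ ^ 2 = (inner ℝ (G i y) (G i y) : ℝ) :=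
    fun i y ↦ (real_inner_self_eq_norm_sq _).symm
  have hpos : ∀ i, ∀ y ∈ e.baseSet, (0 : ℝ) < inner ℝ (G i y) (G i y) :=
    fun i y hy ↦ real_inner_self_pos.mpr (hG0 i y hy)
  have hG : ∀ i, ContMDiffOn (𝓡 n) (𝓡 n).tangent ∞
      (fun y ↦ (⟨y, G i y⟩ : TangentBundle (𝓡 n) M)) e.baseSet := by
    intro i
    induction i using WellFoundedLT.induction with
    | ind i ih =>
      -- The projections are written with inner products only, each of which is smooth in `y`.
      have hdef : ∀ y, G i y = e.localFrame b i y - ∑ j ∈ Finset.Iio i,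
          ((inner ℝ (G j y) (e.localFrame b i y) : ℝ) * (inner ℝ (G j y) (G j y) : ℝ)⁻¹) • G j y := by
        intro y
        have := gramSchmidt_def ℝ (fun i ↦ e.localFrame b i y) i
        simp only [Submodule.starProjection_singleton] at this
        simp only [← hsq, ← div_eq_mul_inv]
        exact this
      simp only [hdef]
      refine ContMDiffOn.sub_section (e.contMDiffOn_localFrame_baseSet ∞ b i)
        (ContMDiffOn.sum_section fun j hj ↦ ContMDiffOn.smul_section ?_ (ih j (Finset.mem_Iio.mp hj)))
      exact (ContMDiffOn.inner_bundle (b := fun y ↦ y) (ih j (Finset.mem_Iio.mp hj))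
        (e.contMDiffOn_localFrame_baseSet ∞ b i)).mul
        ((ContMDiffOn.inner_bundle (b := fun y ↦ y) (ih j (Finset.mem_Iio.mp hj))
          (ih j (Finset.mem_Iio.mp hj))).inv₀ fun y hy ↦ (hpos j y hy).ne')
  have hN : ∀ i, ContMDiffOn (𝓡 n) (𝓡 n).tangent ∞ (fun y ↦
      (⟨y, (Real.sqrt (inner ℝ (G i y) (G i y)))⁻¹ • G i y⟩ : TangentBundle (𝓡 n) M)) e.baseSet := by
    intro i
    refine ContMDiffOn.smul_section (ContMDiffOn.inv₀ (fun y hy ↦ ?_) fun y hy ↦ ?_) (hG i)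
    · exact (Real.contDiffAt_sqrt (hpos i y hy).ne').contMDiffAt.comp_contMDiffWithinAt y
        (ContMDiffOn.inner_bundle (b := fun y ↦ y) (hG i) (hG i) y hy)
    · exact (Real.sqrt_pos.mpr (hpos i y hy)).ne'
  choose E hE hEG using fun i ↦ exists_smoothField_eventuallyEq e.open_baseSet hx (hN i)
  refine ⟨E, hE, ?_⟩
  filter_upwards [Filter.eventually_all.mpr hEG, e.open_baseSet.mem_nhds hx] with y hy hyu
  have := gramSchmidtNormed_orthonormal (hli y hyu)
  simp only [hy]
  convert this using 2 with i
  rw [gramSchmidtNormed, ← hsq, Real.sqrt_sq (norm_nonneg _)]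
  rfl

end OrthonormalFrame

/-! ### Rules for directional derivatives -/

section DirectionalDerivative

variable {n : ℕ} {M : Type*} [TopologicalSpace M]
  [ChartedSpace (EuclideanSpace ℝ (Fin n)) M]

theorem dirDeriv_add (X : Π x : M, TangentSpace (𝓡 n) x) {f g : M → ℝ} {x : M}
    (hf : MDifferentiableAt (𝓡 n) 𝓘(ℝ, ℝ) f x) (hg : MDifferentiableAt (𝓡 n) 𝓘(ℝ, ℝ) g x) :
    dirDeriv X (fun y ↦ f y + g y) x = dirDeriv X f x + dirDeriv X g x := by
  simp [dirDeriv, mvfderiv_fun_add hf hg]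

theorem dirDeriv_sq (X : Π x : M, TangentSpace (𝓡 n) x) {f : M → ℝ} {x : M}
    (hf : MDifferentiableAt (𝓡 n) 𝓘(ℝ, ℝ) f x) :
    dirDeriv X (fun y ↦ f y ^ 2) x = 2 * (f x * dirDeriv X f x) := by
  simp only [sq, dirDeriv, mvfderiv_fun_mul hf hf]
  simp
  ring

theorem dirDeriv_const (X : Π x : M, TangentSpace (𝓡 n) x) (c : ℝ) (x : M) :
    dirDeriv X (fun _ ↦ c) x = 0 := by
  simp [dirDeriv, mvfderiv_const]

theorem mdifferentiableAt_finset_sum {ι : Type*} (s : Finset ι) {f : ι → M → ℝ} {x : M}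
    (hf : ∀ i ∈ s, MDifferentiableAt (𝓡 n) 𝓘(ℝ, ℝ) (f i) x) :
    MDifferentiableAt (𝓡 n) 𝓘(ℝ, ℝ) (fun y ↦ ∑ i ∈ s, f i y) x := by
  classical
  induction s using Finset.induction_on with
  | empty => simpa using mdifferentiableAt_const
  | insert a s ha ih =>
    simp only [Finset.sum_insert ha]
    exact (hf a (Finset.mem_insert_self a s)).add
      (ih fun i hi ↦ hf i (Finset.mem_insert_of_mem hi))

theorem dirDeriv_sum (X : Π x : M, TangentSpace (𝓡 n) x) {ι : Type*} (s : Finset ι)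
    {f : ι → M → ℝ} {x : M} (hf : ∀ i ∈ s, MDifferentiableAt (𝓡 n) 𝓘(ℝ, ℝ) (f i) x) :
    dirDeriv X (fun y ↦ ∑ i ∈ s, f i y) x = ∑ i ∈ s, dirDeriv X (f i) x := by
  classical
  induction s using Finset.induction_on with
  | empty => simpa using dirDeriv_const X 0 x
  | insert a s ha ih =>
    have hs : ∀ i ∈ s, MDifferentiableAt (𝓡 n) 𝓘(ℝ, ℝ) (f i) x :=
      fun i hi ↦ hf i (Finset.mem_insert_of_mem hi)
    simp only [Finset.sum_insert ha]
    rw [dirDeriv_add X (hf a (Finset.mem_insert_self a s)) (mdifferentiableAt_finset_sum s hs),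
      ih hs]

end DirectionalDerivative

/-! ### Consequences of parallel torsion -/

section ParallelTorsion

variable {n : ℕ} {M : Type*} [TopologicalSpace M] [T2Space M]
  [ChartedSpace (EuclideanSpace ℝ (Fin n)) M] [IsManifold (𝓡 n) ∞ M]
  [RiemannianBundle (fun x : M ↦ TangentSpace (𝓡 n) x)]
  [IsContMDiffRiemannianBundle (𝓡 n) ∞ (EuclideanSpace ℝ (Fin n))
      (fun x : M ↦ TangentSpace (𝓡 n) x)]
  {cov : LinearConnection n M}

omit [T2Space M] in
theorem IsSmoothField.sigmaForm (hcov : cov.ContMDiffCovariantDerivative ∞)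
    {Y Z W U : Π x : M, TangentSpace (𝓡 n) x}
    (hY : IsSmoothField Y) (hZ : IsSmoothField Z) (hW : IsSmoothField W) (hU : IsSmoothField U) :
    ContMDiff (𝓡 n) 𝓘(ℝ, ℝ) ∞
      (fun y ↦ sigmaForm (cov.torsion y) (Y y) (Z y) (W y) (U y)) :=
  (((hY.torsion hcov hZ).inner (hW.torsion hcov hU)).add
    ((hZ.torsion hcov hW).inner (hY.torsion hcov hU))).add
    ((hW.torsion hcov hY).inner (hZ.torsion hcov hU))

/-- `σ` is built from the parallel tensors `g` and `T`, hence is parallel itself. -/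
theorem dirDeriv_sigmaForm (hcov : cov.ContMDiffCovariantDerivative ∞)
    (hmetric : cov.IsMetricCompatible) (hparallel : HasParallelTorsion cov)
    {X Y Z W U : Π x : M, TangentSpace (𝓡 n) x} (hX : IsSmoothField X)
    (hY : IsSmoothField Y) (hZ : IsSmoothField Z) (hW : IsSmoothField W) (hU : IsSmoothField U)
    (x : M) :
    dirDeriv X (fun y ↦ sigmaForm (cov.torsion y) (Y y) (Z y) (W y) (U y)) x =
      sigmaForm (cov.torsion x) (cov Y x (X x)) (Z x) (W x) (U x)
      + sigmaForm (cov.torsion x) (Y x) (cov Z x (X x)) (W x) (U x)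
      + sigmaForm (cov.torsion x) (Y x) (Z x) (cov W x (X x)) (U x)
      + sigmaForm (cov.torsion x) (Y x) (Z x) (W x) (cov U x (X x)) := by
  have hd : ∀ {A B C D : Π x : M, TangentSpace (𝓡 n) x}, IsSmoothField A → IsSmoothField B →
      IsSmoothField C → IsSmoothField D → MDifferentiableAt (𝓡 n) 𝓘(ℝ, ℝ)
        (fun y ↦ (inner ℝ (cov.torsion y (A y) (B y)) (cov.torsion y (C y) (D y)) : ℝ)) x :=
    fun hA hB hC hD ↦ ((hA.torsion hcov hB).inner (hC.torsion hcov hD) x).mdifferentiableAt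
      (by simp)
  have hI : ∀ {A B C D : Π x : M, TangentSpace (𝓡 n) x}, IsSmoothField A → IsSmoothField B →
      IsSmoothField C → IsSmoothField D → dirDeriv X
        (fun y ↦ (inner ℝ (cov.torsion y (A y) (B y)) (cov.torsion y (C y) (D y)) : ℝ)) x =
        (inner ℝ (cov.torsion x (cov A x (X x)) (B x)) (cov.torsion x (C x) (D x))
          + inner ℝ (cov.torsion x (A x) (cov B x (X x))) (cov.torsion x (C x) (D x)))
        + (inner ℝ (cov.torsion x (A x) (B x)) (cov.torsion x (cov C x (X x)) (D x))
          + inner ℝ (cov.torsion x (A x) (B x)) (cov.torsion x (C x) (cov D x (X x)))) := by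
    intro A B C D hA hB hC hD
    rw [dirDeriv_inner hmetric X (hA.torsion hcov hB) (hC.torsion hcov hD),
      cov_torsion hcov hmetric hparallel hX hA hB, cov_torsion hcov hmetric hparallel hX hC hD,
      inner_add_left, inner_add_right]
  have hsum := dirDeriv_add X ((hd hY hZ hW hU).add (hd hZ hW hY hU)) (hd hW hY hZ hU)
  have hsum' := dirDeriv_add X (hd hY hZ hW hU) (hd hZ hW hY hU)
  rw [hI hY hZ hW hU, hI hZ hW hY hU] at hsum'
  rw [hI hW hY hZ hU] at hsum
  refine hsum.trans ?_
  refine (congrArg (· + _) hsum').trans ?_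
  simp only [sigmaForm]
  ring

omit [RiemannianBundle (fun x : M ↦ TangentSpace (𝓡 n) x)]
  [IsContMDiffRiemannianBundle (𝓡 n) ∞ (EuclideanSpace ℝ (Fin n))
      (fun x : M ↦ TangentSpace (𝓡 n) x)] in
-- Meant for a `p` defined through bases chosen independently at each point: its regularity comes
-- from local expressions `F` in smooth frames.
theorem apply_eq_of_locally_dirDeriv_eq_zero [ConnectedSpace M] {p : M → ℝ}
    (h : ∀ x, ∃ F : M → ℝ, p =ᶠ[nhds x] F ∧ MDifferentiableAt (𝓡 n) 𝓘(ℝ, ℝ) F x ∧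
      ∀ X : Π x : M, TangentSpace (𝓡 n) x, IsSmoothField X → dirDeriv X F x = 0) (x y : M) :
    p x = p y := by
  refine eq_of_dirDeriv_eq_zero (n := n) (fun z ↦ ?_) (fun z v ↦ ?_) x y
  · obtain ⟨F, hpF, hF, -⟩ := h z
    exact hF.congr_of_eventuallyEq hpF
  · obtain ⟨F, hpF, hF, hX⟩ := h z
    obtain ⟨X, hXs, rfl⟩ := exists_smoothField_apply_eq z v
    exact (dirDeriv_congr X hpF).trans (hX X hXs)

omit [T2Space M] in
-- The Gram matrix is constant near `x`, so the covariant derivative of the frame is an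
-- infinitesimal rotation.
theorem inner_cov_add_inner_cov_of_orthonormal (hmetric : cov.IsMetricCompatible)
    {E : Fin n → Π x : M, TangentSpace (𝓡 n) x} (hE : ∀ i, IsSmoothField (E i)) {x : M}
    (hEo : ∀ᶠ y in nhds x, Orthonormal ℝ (fun i ↦ E i y)) (X : Π x : M, TangentSpace (𝓡 n) x)
    (i j : Fin n) :
    (inner ℝ (cov (E i) x (X x)) (E j x) : ℝ) + inner ℝ (E i x) (cov (E j) x (X x)) = 0 := by
  rw [← dirDeriv_inner hmetric X (hE i) (hE j),
    ← dirDeriv_const X (if i = j then (1 : ℝ) else 0) x]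
  refine dirDeriv_congr X ?_
  filter_upwards [hEo] with y hy
  exact orthonormal_iff_ite.mp hy i j

end ParallelTorsion

instance finiteDimensional_tangentSpace {n : ℕ} [NeZero n] {M : Type*} [TopologicalSpace M]
    [ChartedSpace (EuclideanSpace ℝ (Fin n)) M]
    [RiemannianBundle (fun x : M ↦ TangentSpace (𝓡 n) x)] (x : M) :
    FiniteDimensional ℝ (TangentSpace (𝓡 n) x) := by
  refine Module.finite_of_finrank_pos ?_
  rw [(Fact.out : finrank ℝ (TangentSpace (𝓡 n) x) = n)]
  exact Nat.pos_of_neZero n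

/-! ### Constancy of the normal form -/

section NormalForm

variable {M : Type*} [TopologicalSpace M] [T2Space M]
  [ChartedSpace (EuclideanSpace ℝ (Fin 5)) M] [IsManifold (𝓡 5) ∞ M]
  [RiemannianBundle (fun x : M ↦ TangentSpace (𝓡 5) x)]
  [IsContMDiffRiemannianBundle (𝓡 5) ∞ (EuclideanSpace ℝ (Fin 5))
      (fun x : M ↦ TangentSpace (𝓡 5) x)]
  {cov : LinearConnection 5 M}

omit [T2Space M] [IsManifold (𝓡 5) ∞ M]
    [IsContMDiffRiemannianBundle (𝓡 5) ∞ (EuclideanSpace ℝ (Fin 5))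
      (fun x : M ↦ TangentSpace (𝓡 5) x)] in
theorem exists_orthonormalBasis_of_orthonormal {x : M} {v : Fin 5 → TangentSpace (𝓡 5) x}
    (hv : Orthonormal ℝ v) :
    ∃ b : OrthonormalBasis (Fin 5) ℝ (TangentSpace (𝓡 5) x), ∀ i, b i = v i := by
  obtain ⟨b, hb⟩ := exists_orthonormalBasis_five Fact.out (v := v) Set.univ
    (fun i _ j _ ↦ orthonormal_iff_ite.mp hv i j)
  exact ⟨b, fun i ↦ hb i (Set.mem_univ i)⟩

variable [ConnectedSpace M]

/-- The squared norm of a parallel torsion is constant. -/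
theorem sum_sq_normalForm_const (hcov : cov.ContMDiffCovariantDerivative ∞)
    (hmetric : cov.IsMetricCompatible) (hskew : HasSkewTorsion cov)
    (hparallel : HasParallelTorsion cov) {r l : M → ℝ}
    {e : Π x : M, OrthonormalBasis (Fin 5) ℝ (TangentSpace (𝓡 5) x)}
    (he : ∀ x, NormalFormIn (cov.torsion x) (r x) (l x) (e x)) (x y : M) :
    r x ^ 2 + l x ^ 2 = r y ^ 2 + l y ^ 2 := by
  suffices h : 6 * (r x ^ 2 + l x ^ 2) = 6 * (r y ^ 2 + l y ^ 2) by linarith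
  refine apply_eq_of_locally_dirDeriv_eq_zero (n := 5)
    (p := fun x ↦ 6 * (r x ^ 2 + l x ^ 2)) (fun x ↦ ?_) x y
  obtain ⟨E, hE, hEo⟩ := exists_smooth_orthonormal_frame (n := 5) x
  have ht : ∀ i j k, MDifferentiableAt (𝓡 5) 𝓘(ℝ, ℝ)
      (fun y ↦ (inner ℝ (cov.torsion y (E i y) (E j y)) (E k y) : ℝ)) x := fun i j k ↦
    (((hE i).torsion hcov (hE j)).inner (hE k) x).mdifferentiableAt (by simp)
  have ht2 : ∀ i j k, MDifferentiableAt (𝓡 5) 𝓘(ℝ, ℝ)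
      (fun y ↦ (inner ℝ (cov.torsion y (E i y) (E j y)) (E k y) : ℝ) ^ 2) x := fun i j k ↦
    (ht i j k).pow 2
  refine ⟨fun y ↦ ∑ i, ∑ j, ∑ k, (inner ℝ (cov.torsion y (E i y) (E j y)) (E k y) : ℝ) ^ 2,
    ?_, ?_, fun X hX ↦ ?_⟩
  · filter_upwards [hEo] with y hy
    obtain ⟨b, hb⟩ := exists_orthonormalBasis_of_orthonormal hy
    simp only [← hb]
    exact ((he y).sum_sq_inner (isSkewBilin_torsion hskew y) b).symm
  · exact mdifferentiableAt_finset_sum _ fun i _ ↦ mdifferentiableAt_finset_sum _ fun j _ ↦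
      mdifferentiableAt_finset_sum _ fun k _ ↦ ht2 i j k
  · rw [dirDeriv_sum X _ fun i _ ↦ mdifferentiableAt_finset_sum _ fun j _ ↦
      mdifferentiableAt_finset_sum _ fun k _ ↦ ht2 i j k]
    simp only [fun i ↦ dirDeriv_sum X Finset.univ fun j _ ↦
      mdifferentiableAt_finset_sum Finset.univ fun k _ ↦ ht2 i j k,
      fun i j ↦ dirDeriv_sum X Finset.univ fun k _ ↦ ht2 i j k, dirDeriv_sq X (ht _ _ _),
      ← Finset.mul_sum]
    obtain ⟨b, hb⟩ := exists_orthonormalBasis_of_orthonormal hEo.self_of_nhds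
    -- By `∇T = 0` the derivative of a component of `T` only involves the derivatives of the frame
    -- vectors, which form an infinitesimal rotation.
    have key := (isSkewBilin_torsion hskew x).sum_mul_eq_zero b
      (w := fun i ↦ cov (E i) x (X x)) (fun i j ↦ by
        simpa only [hb] using inner_cov_add_inner_cov_of_orthonormal hmetric hE hEo X i j)
    simp only [hb] at key
    rw [mul_eq_zero]
    right
    rw [← key]
    refine Finset.sum_congr rfl fun i _ ↦ Finset.sum_congr rfl fun j _ ↦
      Finset.sum_congr rfl fun k _ ↦ ?_
    congr 1
    have := hparallel X (E i) (E j) (E k) hX (hE i) (hE j) (hE k) x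
    simp only [torsionTensor] at this
    linarith

/-- The norm of `σ` is constant if the torsion is parallel. -/
theorem sq_mul_normalForm_const (hcov : cov.ContMDiffCovariantDerivative ∞)
    (hmetric : cov.IsMetricCompatible)
    (hparallel : HasParallelTorsion cov) {r l : M → ℝ}
    {e : Π x : M, OrthonormalBasis (Fin 5) ℝ (TangentSpace (𝓡 5) x)}
    (he : ∀ x, NormalFormIn (cov.torsion x) (r x) (l x) (e x)) (x y : M) :
    (r x * l x) ^ 2 = (r y * l y) ^ 2 := by
  suffices h : (r x * l x) ^ 2 * fourFormNormSq = (r y * l y) ^ 2 * fourFormNormSq from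
    mul_right_cancel₀ fourFormNormSq_pos.ne' h
  refine apply_eq_of_locally_dirDeriv_eq_zero (n := 5)
    (p := fun x ↦ (r x * l x) ^ 2 * fourFormNormSq) (fun x ↦ ?_) x y
  obtain ⟨E, hE, hEo⟩ := exists_smooth_orthonormal_frame (n := 5) x
  have ht : ∀ i j k m, MDifferentiableAt (𝓡 5) 𝓘(ℝ, ℝ)
      (fun y ↦ sigmaForm (cov.torsion y) (E i y) (E j y) (E k y) (E m y)) x := fun i j k m ↦
    ((hE i).sigmaForm hcov (hE j) (hE k) (hE m) x).mdifferentiableAt (by simp)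
  have ht2 : ∀ i j k m, MDifferentiableAt (𝓡 5) 𝓘(ℝ, ℝ)
      (fun y ↦ sigmaForm (cov.torsion y) (E i y) (E j y) (E k y) (E m y) ^ 2) x :=
    fun i j k m ↦ (ht i j k m).pow 2
  refine ⟨fun y ↦ ∑ i, ∑ j, ∑ k, ∑ m,
    sigmaForm (cov.torsion y) (E i y) (E j y) (E k y) (E m y) ^ 2, ?_, ?_, fun X hX ↦ ?_⟩
  · filter_upwards [hEo] with y hy
    obtain ⟨b, hb⟩ := exists_orthonormalBasis_of_orthonormal hy
    simp only [← hb]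
    exact ((he y).sum_sq_sigmaForm b).symm
  · exact mdifferentiableAt_finset_sum _ fun i _ ↦ mdifferentiableAt_finset_sum _ fun j _ ↦
      mdifferentiableAt_finset_sum _ fun k _ ↦ mdifferentiableAt_finset_sum _ fun m _ ↦ ht2 i j k m
  · rw [dirDeriv_sum X _ fun i _ ↦ mdifferentiableAt_finset_sum _ fun j _ ↦
      mdifferentiableAt_finset_sum _ fun k _ ↦ mdifferentiableAt_finset_sum _ fun m _ ↦ ht2 i j k m]
    simp only [fun i ↦ dirDeriv_sum X Finset.univ fun j _ ↦
      mdifferentiableAt_finset_sum Finset.univ fun k _ ↦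
        mdifferentiableAt_finset_sum Finset.univ fun m _ ↦ ht2 i j k m,
      fun i j ↦ dirDeriv_sum X Finset.univ fun k _ ↦
        mdifferentiableAt_finset_sum Finset.univ fun m _ ↦ ht2 i j k m,
      fun i j k ↦ dirDeriv_sum X Finset.univ fun m _ ↦ ht2 i j k m,
      dirDeriv_sq X (ht _ _ _ _), ← Finset.mul_sum]
    obtain ⟨b, hb⟩ := exists_orthonormalBasis_of_orthonormal hEo.self_of_nhds
    have key := sum_sigmaForm_mul_eq_zero (cov.torsion x) b
      (w := fun i ↦ cov (E i) x (X x)) (fun i j ↦ by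
        simpa only [hb] using inner_cov_add_inner_cov_of_orthonormal hmetric hE hEo X i j)
    simp only [hb] at key
    rw [mul_eq_zero]
    right
    rw [← key]
    refine Finset.sum_congr rfl fun i _ ↦ Finset.sum_congr rfl fun j _ ↦
      Finset.sum_congr rfl fun k _ ↦ Finset.sum_congr rfl fun m _ ↦ ?_
    rw [dirDeriv_sigmaForm hcov hmetric hparallel hX (hE i) (hE j) (hE k) (hE m)]

/-- The two invariants determine `(a + b)²` and `(a - b)²`, and the order conditions fix the signs
of the roots. -/
theorem eq_and_eq_of_sq_add_sq_eq {a b c d : ℝ} (hb : 0 ≤ b) (hab : b ≤ a) (hd : 0 ≤ d)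
    (hcd : d ≤ c) (h₁ : a ^ 2 + b ^ 2 = c ^ 2 + d ^ 2) (h₂ : (a * b) ^ 2 = (c * d) ^ 2) :
    a = c ∧ b = d := by
  have h3 : a * b = c * d := by
    rwa [sq_eq_sq₀ (by nlinarith) (by nlinarith)] at h₂
  have h4 : a + b = c + d := by
    rw [← sq_eq_sq₀ (by linarith) (by linarith)]; nlinarith
  have h5 : a - b = c - d := by
    rw [← sq_eq_sq₀ (by linarith) (by linarith)]; nlinarith
  constructor <;> linarith

theorem exists_hasTorsionNormalForm (o : Π x : M, Orientation ℝ (TangentSpace (𝓡 5) x) (Fin 5))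
    (hcov : cov.ContMDiffCovariantDerivative ∞)
    (hmetric : cov.IsMetricCompatible) (hskew : HasSkewTorsion cov)
    (hparallel : HasParallelTorsion cov)
    (hsigma : ∃ (x : M) (X Y Z V : TangentSpace (𝓡 5) x), sigmaT cov x X Y Z V ≠ 0) :
    ∃ rho lam : ℝ, 0 < rho ∧ 0 < lam ∧ HasTorsionNormalForm o cov rho lam := by
  choose r l e hl hrl ho he using fun x : M ↦
    (isSkewBilin_torsion hskew x).exists_oriented_normalFormIn Fact.out (o x)
  obtain ⟨x, X, Y, Z, V, hx⟩ := hsigma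
  have hx' : r x * l x ≠ 0 := by
    intro h0
    refine hx ?_
    have := (he x).sigmaForm_eq X Y Z V
    rw [h0, zero_mul] at this
    exact this
  -- Both constants are positive at the one point where `σ` is known not to vanish; constancy
  -- carries this to all of `M`.
  have hlx : 0 < l x := lt_of_le_of_ne (hl x) (right_ne_zero_of_mul hx').symm
  refine ⟨r x, l x, hlx.trans_le (hrl x), hlx, fun y ↦ ⟨e y, ho y, fun A B C ↦ ?_⟩⟩
  obtain ⟨h1, h2⟩ := eq_and_eq_of_sq_add_sq_eq (hl y) (hrl y) (hl x) (hrl x)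
    (sum_sq_normalForm_const hcov hmetric hskew hparallel he y x)
    (sq_mul_normalForm_const hcov hmetric hparallel he y x)
  rw [← h1, ← h2]
  exact he y A B C

end NormalForm

/-! ### Algebra behind the uniqueness of the characteristic connection -/

section CharacteristicAlgebra

variable {V : Type*} [NormedAddCommGroup V] [InnerProductSpace ℝ V]

/-- A three-form annihilated by `ξ` on which `φ` acts as a derivation with value zero in each pair
of slots vanishes. -/
theorem eq_zero_of_skew_of_commute {D : V →L[ℝ] V →L[ℝ] V} {φ : V →ₗ[ℝ] V} {ξ : V} {η : V →ₗ[ℝ] ℝ}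
    (hφ2 : ∀ v, φ (φ v) = -v + η v • ξ) (hφ : ∀ v w, (inner ℝ (φ v) w : ℝ) = -inner ℝ v (φ w))
    (hm : ∀ u w z, (inner ℝ (D u w) z : ℝ) + inner ℝ u (D z w) = 0)
    (ht : ∀ x y z, (inner ℝ (D y x - D x y) z : ℝ) = -inner ℝ (D z x - D x z) y)
    (hDφ : ∀ u w, D (φ u) w = φ (D u w)) (hDξ : ∀ w, D ξ w = 0) (u w : V) : D u w = 0 := by
  have h23 : ∀ x y z, (inner ℝ (D y x) z : ℝ) = -inner ℝ (D z x) y := fun x y z ↦ by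
    rw [real_inner_comm y (D z x)]
    linarith [hm y x z]
  have h13 : ∀ x y z, (inner ℝ (D y x) z : ℝ) = -inner ℝ (D y z) x := fun x y z ↦ by
    have := ht y x z
    simp only [inner_sub_left] at this
    linarith [h23 y x z, h23 x y z, h23 z y x]
  have hφ23 : ∀ x y z, (inner ℝ (D (φ y) x) z : ℝ) = -inner ℝ (D y x) (φ z) := fun x y z ↦ by
    rw [hDφ, hφ]
  have hφ12 : ∀ x y z, (inner ℝ (D y (φ x)) z : ℝ) = -inner ℝ (D (φ y) x) z := fun x y z ↦ by
    linarith [h13 (φ x) y z, hφ23 z y x, h13 x (φ y) z]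
  -- Moving `φ` through all three slots and back to its first place costs an odd number of signs.
  have hzero : ∀ x y z, (inner ℝ (D (φ y) x) z : ℝ) = 0 := fun x y z ↦ by
    linarith [hφ23 x y z, hφ12 x y z, h23 (φ x) y z, hφ12 x z y, h23 x (φ z) y]
  refine ext_inner_right ℝ fun z ↦ ?_
  -- Inserting `φ u` produces `φ² u = -u + η(u) ξ`, and `ξ` is annihilated.
  have h := hzero w (φ u) z
  rw [hφ2] at h
  simpa [hDξ] using h

end CharacteristicAlgebra

/-! ### Almost contact structures and their characteristic connections -/

namespace MetricAlmostContactStructure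

section Algebra

variable {n : ℕ} {M : Type*} [TopologicalSpace M]
  [ChartedSpace (EuclideanSpace ℝ (Fin n)) M] [IsManifold (𝓡 n) ∞ M]
  [RiemannianBundle (fun x : M ↦ TangentSpace (𝓡 n) x)]
  (S : MetricAlmostContactStructure n M)

theorem φ_ξ (x : M) : S.φ x (S.ξ x) = 0 := by
  rw [← inner_self_eq_zero (𝕜 := ℝ), S.φ_compat, S.η_dual, S.norm_ξ]
  norm_num

theorem ξ_ne_zero (x : M) : S.ξ x ≠ 0 := fun h ↦ by
  have := S.norm_ξ x
  simp [h] at this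

/-- Compare `φ² (φ V)` with `φ (φ² V)`, using `φ ξ = 0`. -/
theorem η_φ (x : M) (V : TangentSpace (𝓡 n) x) : S.η x (S.φ x V) = 0 := by
  have h := congrArg (S.φ x) (S.φ_sq x V)
  rw [S.φ_sq, map_add, map_neg, map_smul, S.φ_ξ, smul_zero] at h
  exact (smul_eq_zero.mp (add_left_cancel h)).resolve_right (S.ξ_ne_zero x)

theorem inner_φ_left (x : M) (V W : TangentSpace (𝓡 n) x) :
    (inner ℝ (S.φ x V) W : ℝ) = -inner ℝ V (S.φ x W) := by
  have h := S.φ_compat x V (S.φ x W)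
  have hη := S.η_φ x V
  rw [S.η_dual, real_inner_comm] at hη
  rw [S.φ_sq, S.η_φ, inner_add_right, inner_neg_right, inner_smul_right, hη] at h
  linarith

end Algebra

section Connection

variable {n : ℕ} {M : Type*} [TopologicalSpace M]
  [ChartedSpace (EuclideanSpace ℝ (Fin n)) M] [IsManifold (𝓡 n) ∞ M]
  [RiemannianBundle (fun x : M ↦ TangentSpace (𝓡 n) x)]
  [IsContMDiffRiemannianBundle (𝓡 n) ∞ (EuclideanSpace ℝ (Fin n))
      (fun x : M ↦ TangentSpace (𝓡 n) x)]
  {S : MetricAlmostContactStructure n M} {cov cov' : LinearConnection n M}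
  {X Y Z : Π x : M, TangentSpace (𝓡 n) x}

omit [RiemannianBundle (fun x : M ↦ TangentSpace (𝓡 n) x)]
  [IsContMDiffRiemannianBundle (𝓡 n) ∞ (EuclideanSpace ℝ (Fin n))
      (fun x : M ↦ TangentSpace (𝓡 n) x)] in
theorem _root_.mlieBracket_eq_cov (cov : LinearConnection n M) (hX : IsSmoothField X)
    (hY : IsSmoothField Y) (x : M) :
    mlieBracket (𝓡 n) X Y x = cov Y x (X x) - cov X x (Y x) - cov.torsion x (X x) (Y x) := by
  rw [cov.torsion_apply (hX.mdifferentiableAt x) (hY.mdifferentiableAt x)]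
  abel

namespace IsCharacteristicConnection

theorem dη_eq (h : S.IsCharacteristicConnection cov) (hX : IsSmoothField X)
    (hY : IsSmoothField Y) (x : M) :
    S.dη X Y x = inner ℝ (S.ξ x) (cov.torsion x (X x) (Y x)) := by
  have h1 := h.parallel_η X Y hX hY x
  have h2 := h.parallel_η Y X hY hX x
  rw [dη, mlieBracket_eq_cov cov hX hY, ← S.η_dual, map_sub, map_sub]
  linarith

/-- After brackets are expressed through `∇` and `T`, parallelism of `φ` cancels all derivatives.
The `ξ`-component of `-φ² T(X,Y)` cancels against `dη(X,Y) ξ`. -/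
theorem N_eq (h : S.IsCharacteristicConnection cov) (hX : IsSmoothField X)
    (hY : IsSmoothField Y) (x : M) :
    S.N X Y x = cov.torsion x (X x) (Y x)
      - cov.torsion x (S.φ x (X x)) (S.φ x (Y x))
      + S.φ x (cov.torsion x (X x) (S.φ x (Y x)))
      + S.φ x (cov.torsion x (S.φ x (X x)) (Y x)) := by
  have hφX := S.smooth_φ X hX
  have hφY := S.smooth_φ Y hY
  have h1 := sub_eq_zero.mp (h.parallel_φ (fun y ↦ S.φ y (X y)) Y hφX hY x)
  have h2 := sub_eq_zero.mp (h.parallel_φ (fun y ↦ S.φ y (Y y)) X hφY hX x)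
  have h3 := sub_eq_zero.mp (h.parallel_φ X Y hX hY x)
  have h4 := sub_eq_zero.mp (h.parallel_φ Y X hY hX x)
  rw [N, h.dη_eq hX hY, mlieBracket_eq_cov cov hφX hφY, mlieBracket_eq_cov cov hX hφY,
    mlieBracket_eq_cov cov hφX hY, mlieBracket_eq_cov cov hX hY, h1, h2, h3, h4, ← S.η_dual]
  have h5 := S.φ_sq x (cov.torsion x (X x) (Y x))
  simp only [map_sub, h5]
  abel

theorem dF_eq (h : S.IsCharacteristicConnection cov) (hX : IsSmoothField X)
    (hY : IsSmoothField Y) (hZ : IsSmoothField Z) (x : M) :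
    S.dF X Y Z x = inner ℝ (cov.torsion x (X x) (Y x)) (S.φ x (Z x))
      + inner ℝ (cov.torsion x (Y x) (Z x)) (S.φ x (X x))
      + inner ℝ (cov.torsion x (Z x) (X x)) (S.φ x (Y x)) := by
  have hd : ∀ {A B C : Π x : M, TangentSpace (𝓡 n) x}, IsSmoothField A → IsSmoothField B →
      IsSmoothField C → dirDeriv A (fun y ↦ S.F y (B y) (C y)) x =
        inner ℝ (cov B x (A x)) (S.φ x (C x)) - inner ℝ (cov C x (A x)) (S.φ x (B x)) := by
    intro A B C hA hB hC
    have h1 := dirDeriv_inner h.metric A hB (S.smooth_φ C hC) x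
    rw [sub_eq_zero.mp (h.parallel_φ A C hA hC x)] at h1
    have h2 := S.inner_φ_left x (B x) (cov C x (A x))
    rw [real_inner_comm] at h2
    simp only [F]
    linarith
  rw [dF, hd hX hY hZ, hd hY hX hZ, hd hZ hX hY, mlieBracket_eq_cov cov hX hY,
    mlieBracket_eq_cov cov hX hZ, mlieBracket_eq_cov cov hY hZ, cov.torsion_antisymm (Z x) (X x)]
  simp only [F, inner_sub_left, inner_neg_left]
  ring

/-- The difference of two connections is tensorial. It is skew because both are metric with skew
torsion, commutes with `φ` and kills `ξ`, so the algebraic vanishing lemma applies. -/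
theorem cov_eq [T2Space M] (h : S.IsCharacteristicConnection cov)
    (h' : S.IsCharacteristicConnection cov') (hY : IsSmoothField Y) (x : M)
    (v : TangentSpace (𝓡 n) x) : cov' Y x v = cov Y x v := by
  have hD : ∀ {W : Π x : M, TangentSpace (𝓡 n) x}, IsSmoothField W → ∀ v,
      cov'.difference cov x (W x) v = cov' W x v - cov W x v := fun hW v ↦ by
    rw [CovariantDerivative.difference,
      IsCovariantDerivativeOn.difference_apply _ _ (Set.mem_univ x) (hW.mdifferentiableAt x)]
    rfl
  have ht : ∀ {A B : Π x : M, TangentSpace (𝓡 n) x}, IsSmoothField A → IsSmoothField B →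
      cov'.difference cov x (B x) (A x) - cov'.difference cov x (A x) (B x) =
        cov'.torsion x (A x) (B x) - cov.torsion x (A x) (B x) := fun hA hB ↦ by
    rw [hD hA, hD hB, cov.torsion_apply (hA.mdifferentiableAt x) (hB.mdifferentiableAt x),
      cov'.torsion_apply (hA.mdifferentiableAt x) (hB.mdifferentiableAt x)]
    abel
  rw [← sub_eq_zero, ← hD hY]
  refine eq_zero_of_skew_of_commute (S.φ_sq x) (S.inner_φ_left x) ?_ ?_ ?_ ?_ (Y x) v
  · intro u w z
    obtain ⟨U, hU, rfl⟩ := exists_smoothField_apply_eq x u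
    obtain ⟨W, hW, rfl⟩ := exists_smoothField_apply_eq x w
    obtain ⟨Z, hZ, rfl⟩ := exists_smoothField_apply_eq x z
    rw [hD hU, hD hZ, inner_sub_left, inner_sub_right]
    linarith [dirDeriv_inner h.metric W hU hZ x, dirDeriv_inner h'.metric W hU hZ x]
  · intro a b c
    obtain ⟨A, hA, rfl⟩ := exists_smoothField_apply_eq x a
    obtain ⟨B, hB, rfl⟩ := exists_smoothField_apply_eq x b
    obtain ⟨C, hC, rfl⟩ := exists_smoothField_apply_eq x c
    rw [ht hA hB, ht hA hC, inner_sub_left, inner_sub_left]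
    have h1 := h.skew x (A x) (B x) (C x)
    have h2 := h'.skew x (A x) (B x) (C x)
    simp only [torsionTensor] at h1 h2
    linarith
  · intro u w
    obtain ⟨U, hU, rfl⟩ := exists_smoothField_apply_eq x u
    obtain ⟨W, hW, rfl⟩ := exists_smoothField_apply_eq x w
    have h1 := hD (S.smooth_φ U hU) (W x)
    rw [sub_eq_zero.mp (h.parallel_φ W U hW hU x), sub_eq_zero.mp (h'.parallel_φ W U hW hU x)]
      at h1
    rw [h1, hD hU, map_sub]
  · intro w
    rw [hD S.smooth_ξ, h.parallel_ξ, h'.parallel_ξ, sub_zero]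

end IsCharacteristicConnection

end Connection

end MetricAlmostContactStructure

/-! ### Linearity of the covariant derivative -/

section CovariantLinear

variable {n : ℕ} {M : Type*} [TopologicalSpace M]
  [ChartedSpace (EuclideanSpace ℝ (Fin n)) M] [IsManifold (𝓡 n) ∞ M]
  (cov : LinearConnection n M) {Y Z : Π x : M, TangentSpace (𝓡 n) x}

theorem cov_add (hY : IsSmoothField Y) (hZ : IsSmoothField Z) (x : M)
    (v : TangentSpace (𝓡 n) x) : cov (fun y ↦ Y y + Z y) x v = cov Y x v + cov Z x v := by
  have h := cov.isCovariantDerivativeOnUniv.add (hY.mdifferentiableAt x) (hZ.mdifferentiableAt x)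
  exact congrArg (fun L : TangentSpace (𝓡 n) x →L[ℝ] TangentSpace (𝓡 n) x ↦ L v) h

theorem cov_const_smul (c : ℝ) (hY : IsSmoothField Y) (x : M)
    (v : TangentSpace (𝓡 n) x) : cov (fun y ↦ c • Y y) x v = c • cov Y x v := by
  have h := cov.isCovariantDerivativeOnUniv.smul_const c (hY.mdifferentiableAt x)
  exact congrArg (fun L : TangentSpace (𝓡 n) x →L[ℝ] TangentSpace (𝓡 n) x ↦ L v) h

end CovariantLinear

/-! ### The contact endomorphism is smooth and parallel -/

section ContactEndo

variable {n : ℕ} {M : Type*} [TopologicalSpace M]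
  [ChartedSpace (EuclideanSpace ℝ (Fin n)) M] [IsManifold (𝓡 n) ∞ M]
  [RiemannianBundle (fun x : M ↦ TangentSpace (𝓡 n) x)]
  [IsContMDiffRiemannianBundle (𝓡 n) ∞ (EuclideanSpace ℝ (Fin n))
      (fun x : M ↦ TangentSpace (𝓡 n) x)]
  {cov : LinearConnection n M} {ξ X Y : Π x : M, TangentSpace (𝓡 n) x}

omit [IsContMDiffRiemannianBundle (𝓡 n) ∞ (EuclideanSpace ℝ (Fin n))
      (fun x : M ↦ TangentSpace (𝓡 n) x)] in
theorem IsSmoothField.contactEndo (hcov : cov.ContMDiffCovariantDerivative ∞) (r l : ℝ)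
    (hξ : IsSmoothField ξ) (hY : IsSmoothField Y) :
    IsSmoothField (fun y ↦ contactEndo (cov.torsion y) r l (ξ y) (Y y)) := by
  have h1 := hξ.torsion hcov hY
  exact (h1.const_smul _).add ((hξ.torsion hcov (hξ.torsion hcov h1)).const_smul _)

/-- Since `ξ` is parallel in the direction considered, differentiation commutes with `T(ξ, ·)`,
hence with polynomials in it. -/
theorem cov_contactEndo [T2Space M] (hcov : cov.ContMDiffCovariantDerivative ∞)
    (hmetric : cov.IsMetricCompatible) (hparallel : HasParallelTorsion cov) (r l : ℝ)
    (hξ : IsSmoothField ξ) (hX : IsSmoothField X) (hY : IsSmoothField Y) (x : M)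
    (hξp : cov ξ x (X x) = 0) :
    cov (fun y ↦ contactEndo (cov.torsion y) r l (ξ y) (Y y)) x (X x) =
      contactEndo (cov.torsion x) r l (ξ x) (cov Y x (X x)) := by
  have hT : ∀ {Z : Π x : M, TangentSpace (𝓡 n) x}, IsSmoothField Z →
      cov (fun y ↦ cov.torsion y (ξ y) (Z y)) x (X x) =
        cov.torsion x (ξ x) (cov Z x (X x)) := fun hZ ↦ by
    rw [cov_torsion hcov hmetric hparallel hX hξ hZ, hξp]
    simp
  have h1 := hξ.torsion hcov hY
  have h2 := hξ.torsion hcov h1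
  have h3 := hξ.torsion hcov h2
  simp only [contactEndo_apply]
  rw [cov_add cov (h1.const_smul _) (h3.const_smul _), cov_const_smul cov _ h1,
    cov_const_smul cov _ h3, hT h2, hT h1, hT hY]

end ContactEndo

theorem Orientation.volumeForm_orthonormalBasis {V : Type*} [NormedAddCommGroup V]
    [InnerProductSpace ℝ V] {n : ℕ} [Fact (finrank ℝ V = n)] (o : Orientation ℝ V (Fin n))
    (b : OrthonormalBasis (Fin n) ℝ V) (hb : b.toBasis.orientation = o) : o.volumeForm b = 1 := by
  have h := b.toBasis.det_self
  rwa [b.coe_toBasis, ← o.volumeForm_robust b hb] at h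

/-! ### The Reeb field -/

section Reeb

variable {M : Type*} [TopologicalSpace M]
  [ChartedSpace (EuclideanSpace ℝ (Fin 5)) M] [IsManifold (𝓡 5) ∞ M]
  [RiemannianBundle (fun x : M ↦ TangentSpace (𝓡 5) x)]
  {o : Π x : M, Orientation ℝ (TangentSpace (𝓡 5) x) (Fin 5)}
  {cov : LinearConnection 5 M} {rho lam : ℝ} {x : M}
  {e : OrthonormalBasis (Fin 5) ℝ (TangentSpace (𝓡 5) x)}

namespace IsAdaptedBasis

theorem normalFormIn (h : IsAdaptedBasis o cov rho lam x e) :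
    NormalFormIn (cov.torsion x) rho lam e := h.2

theorem starSigmaIn_eq (h : IsAdaptedBasis o cov rho lam x e)
    (v : Fin 5 → TangentSpace (𝓡 5) x) :
    starSigmaIn (cov.torsion x) v = (rho * lam * (o x).volumeForm v) • e 4 := by
  rw [h.normalFormIn.starSigmaIn_eq, (o x).volumeForm_robust e h.1]

theorem starSigmaT_eq (h : IsAdaptedBasis o cov rho lam x e) :
    starSigmaT o cov x = (rho * lam) • e 4 := by
  have hb := (o x).finOrthonormalBasis_orientation (by norm_num) Fact.out
  refine (h.starSigmaIn_eq _).trans ?_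
  rw [(o x).volumeForm_orthonormalBasis _ hb, mul_one]

theorem smul_starSigmaT_eq (h : IsAdaptedBasis o cov rho lam x e) (h0 : rho * lam ≠ 0) :
    (rho * lam)⁻¹ • starSigmaT o cov x = e 4 := by
  rw [h.starSigmaT_eq, inv_smul_smul₀ h0]

end IsAdaptedBasis

theorem HasTorsionNormalForm.mul_ne_zero (h : HasTorsionNormalForm o cov rho lam)
    (hsigma : ∃ (x : M) (X Y Z V : TangentSpace (𝓡 5) x), sigmaT cov x X Y Z V ≠ 0) :
    rho * lam ≠ 0 := by
  obtain ⟨x, X, Y, Z, V, hx⟩ := hsigma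
  obtain ⟨e, he⟩ := h x
  exact left_ne_zero_of_mul (ne_of_eq_of_ne (he.normalFormIn.sigmaForm_eq X Y Z V).symm hx)

variable [IsContMDiffRiemannianBundle (𝓡 5) ∞ (EuclideanSpace ℝ (Fin 5))
      (fun x : M ↦ TangentSpace (𝓡 5) x)]

theorem IsSmoothField.starSigmaIn (hcov : cov.ContMDiffCovariantDerivative ∞)
    {X : Fin 5 → Π x : M, TangentSpace (𝓡 5) x} (hX : ∀ i, IsSmoothField (X i)) :
    IsSmoothField (fun y ↦ starSigmaIn (cov.torsion y) (fun i ↦ X i y)) :=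
  ContMDiff.sum_section fun k _ ↦ (hX k).smul
    (contMDiff_const.mul ((hX _).sigmaForm hcov (hX _) (hX _) (hX _)))

/-- The bases defining `starSigmaT` need not vary continuously. In a smooth frame extending an
adapted basis at `x`, the analogous vector differs from it by the factor `volumeForm`, which is
smooth and nonzero near `x`. -/
theorem isSmoothField_starSigmaT [T2Space M] (ho : IsSmoothOrientation o)
    (hcov : cov.ContMDiffCovariantDerivative ∞) (h : HasTorsionNormalForm o cov rho lam) :
    IsSmoothField (starSigmaT o cov) := by
  intro x
  obtain ⟨e, he⟩ := h x
  choose X hX hXe using fun i ↦ exists_smoothField_apply_eq x (e i)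
  have hvol := ho X hX
  have hvx : (o x).volumeForm (fun i ↦ X i x) ≠ 0 := by
    simp only [hXe]
    rw [(o x).volumeForm_orthonormalBasis e he.1]
    exact one_ne_zero
  have hsm := ContMDiffAt.smul_section ((hvol x).inv₀ hvx) (IsSmoothField.starSigmaIn hcov hX x)
  refine hsm.congr_of_eventuallyEq ?_
  filter_upwards [hvol.continuous.continuousAt.eventually_ne hvx] with y hy
  obtain ⟨f, hf⟩ := h y
  congr 1
  simp only [Pi.smul_apply', hf.starSigmaT_eq, hf.starSigmaIn_eq, smul_smul]
  congr 1
  field_simp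

/-- Differentiating `σ(ξ, ·, ·, ·) = 0` puts `∇ξ` in the kernel of `σ`, which is the line of `ξ`;
constant length makes `∇ξ` orthogonal to `ξ`. -/
theorem cov_reeb_eq_zero [T2Space M] (hcov : cov.ContMDiffCovariantDerivative ∞)
    (hmetric : cov.IsMetricCompatible) (hparallel : HasParallelTorsion cov)
    {ξ : Π x : M, TangentSpace (𝓡 5) x} (hξ : IsSmoothField ξ)
    (hrl : rho * lam ≠ 0)
    (h : ∀ x, ∃ e : OrthonormalBasis (Fin 5) ℝ (TangentSpace (𝓡 5) x),
      NormalFormIn (cov.torsion x) rho lam e ∧ e 4 = ξ x) (x : M) (v : TangentSpace (𝓡 5) x) :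
    cov ξ x v = 0 := by
  obtain ⟨X, hX, rfl⟩ := exists_smoothField_apply_eq x v
  obtain ⟨e, he, heξ⟩ := h x
  have hσ0 : ∀ y Y Z W, sigmaForm (cov.torsion y) (ξ y) Y Z W = 0 := fun y Y Z W ↦ by
    obtain ⟨f, hf, hfξ⟩ := h y
    rw [← hfξ, hf.sigmaForm_xi]
  have hker : ∀ Y Z W, sigmaForm (cov.torsion x) (cov ξ x (X x)) Y Z W = 0 := by
    intro Y Z W
    obtain ⟨Y, hY, rfl⟩ := exists_smoothField_apply_eq x Y
    obtain ⟨Z, hZ, rfl⟩ := exists_smoothField_apply_eq x Z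
    obtain ⟨W, hW, rfl⟩ := exists_smoothField_apply_eq x W
    have hd := dirDeriv_sigmaForm hcov hmetric hparallel hX hξ hY hZ hW x
    simp only [hσ0, dirDeriv_const, add_zero] at hd
    exact hd.symm
  have hn : (fun y ↦ (inner ℝ (ξ y) (ξ y) : ℝ)) = fun _ ↦ 1 := by
    funext y
    obtain ⟨f, -, hfξ⟩ := h y
    rw [← hfξ, f.inner_apply_ite, if_pos rfl]
  have hperp := dirDeriv_inner hmetric X hξ hξ x
  rw [hn, dirDeriv_const, real_inner_comm] at hperp
  rw [he.eq_smul_of_sigmaForm_eq_zero (left_ne_zero_of_mul hrl) (right_ne_zero_of_mul hrl) hker,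
    heξ, show (inner ℝ (ξ x) (cov ξ x (X x)) : ℝ) = 0 by linarith, zero_smul]

end Reeb

/-! ### The main theorem -/

theorem mainTheorem9 {M : Type*} [TopologicalSpace M] [T2Space M] [ConnectedSpace M]
    [ChartedSpace (EuclideanSpace ℝ (Fin 5)) M] [IsManifold (𝓡 5) ∞ M]
    [RiemannianBundle (fun x : M ↦ TangentSpace (𝓡 5) x)]
    [IsContMDiffRiemannianBundle (𝓡 5) ∞ (EuclideanSpace ℝ (Fin 5))
      (fun x : M ↦ TangentSpace (𝓡 5) x)]
    (o : Π x : M, Orientation ℝ (TangentSpace (𝓡 5) x) (Fin 5)) (ho : IsSmoothOrientation o)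
    (cov : LinearConnection 5 M) (hsmooth : cov.ContMDiffCovariantDerivative ∞)
    (hmetric : cov.IsMetricCompatible) (hskew : HasSkewTorsion cov)
    (hparallel : HasParallelTorsion cov)
    (hsigma : ∃ (x : M) (X Y Z V : TangentSpace (𝓡 5) x), sigmaT cov x X Y Z V ≠ 0) :
    (∃ rho lam : ℝ, 0 < rho ∧ 0 < lam ∧ HasTorsionNormalForm o cov rho lam) ∧
    ∀ rho lam : ℝ, HasTorsionNormalForm o cov rho lam → rho ≠ -lam →
      ∃ S : MetricAlmostContactStructure 5 M,
        (∀ x, S.ξ x = (rho * lam)⁻¹ • starSigmaT o cov x) ∧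
        (∀ (x : M) (e : OrthonormalBasis (Fin 5) ℝ (TangentSpace (𝓡 5) x)),
          IsAdaptedBasis o cov rho lam x e → ∀ X Y : TangentSpace (𝓡 5) x,
            S.F x X Y = -(frameForm e ![0, 1] ![X, Y] + frameForm e ![2, 3] ![X, Y])) ∧
        S.IsQuasiSasakian ∧
        S.IsCharacteristicConnection cov ∧
        (∀ cov' : LinearConnection 5 M, S.IsCharacteristicConnection cov' →
          ∀ Y : Π x : M, TangentSpace (𝓡 5) x, IsSmoothField Y →
            ∀ (x : M) (v : TangentSpace (𝓡 5) x), cov' Y x v = cov Y x v) ∧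
        ((∃ α : ℝ, S.IsAlphaSasakian α) ↔ lam = rho) ∧
        (lam = rho → rho = 2 → S.IsSasakian) := by
  refine ⟨exists_hasTorsionNormalForm o hsmooth hmetric hskew hparallel hsigma,
    fun rho lam hnf hne ↦ ?_⟩
  have hrl := hnf.mul_ne_zero hsigma
  have hr : rho ≠ 0 := left_ne_zero_of_mul hrl
  have hl : lam ≠ 0 := right_ne_zero_of_mul hrl
  have hs : rho + lam ≠ 0 := fun h ↦ hne (eq_neg_of_add_eq_zero_left h)
  let ξ : Π x : M, TangentSpace (𝓡 5) x := fun x ↦ (rho * lam)⁻¹ • starSigmaT o cov x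
  have hξe : ∀ (x : M) (e : OrthonormalBasis (Fin 5) ℝ (TangentSpace (𝓡 5) x)),
      IsAdaptedBasis o cov rho lam x e → ξ x = e 4 := fun x e he ↦ he.smul_starSigmaT_eq hrl
  have hξs : IsSmoothField ξ := (isSmoothField_starSigmaT ho hsmooth hnf).const_smul _
  have hξp : ∀ x v, cov ξ x v = 0 := cov_reeb_eq_zero hsmooth hmetric hparallel hξs hrl fun x ↦ by
    obtain ⟨e, he⟩ := hnf x
    exact ⟨e, he.normalFormIn, (hξe x e he).symm⟩
  let S : MetricAlmostContactStructure 5 M :=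
    { φ := fun x ↦ contactEndo (cov.torsion x) rho lam (ξ x)
      ξ := ξ
      η := fun x ↦ innerₗ (TangentSpace (𝓡 5) x) (ξ x)
      smooth_φ := fun X hX ↦ hξs.contactEndo hsmooth rho lam hX
      smooth_ξ := hξs
      smooth_η := fun X hX ↦ hξs.inner hX
      η_dual := fun x V ↦ rfl
      norm_ξ := fun x ↦ by
        obtain ⟨e, he⟩ := hnf x
        rw [hξe x e he, e.inner_apply_ite, if_pos rfl]
      φ_sq := fun x V ↦ by
        obtain ⟨e, he⟩ := hnf x
        rw [hξe x e he]
        exact he.normalFormIn.contactEndo_sq hr hl hs V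
      φ_compat := fun x V W ↦ by
        obtain ⟨e, he⟩ := hnf x
        rw [hξe x e he]
        exact he.normalFormIn.inner_contactEndo_contactEndo hr hl hs V W }
  have hchar : S.IsCharacteristicConnection cov :=
    { metric := hmetric
      skew := hskew
      parallel_ξ := hξp
      parallel_η := fun X Y hX hY x ↦ by
        refine sub_eq_zero.mpr ((dirDeriv_inner hmetric X hξs hY x).trans ?_)
        rw [hξp, inner_zero_left, zero_add]
        rfl
      parallel_φ := fun X Y hX hY x ↦ sub_eq_zero.mpr
        (cov_contactEndo hsmooth hmetric hparallel rho lam hξs hX hY x (hξp x (X x))) }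
  have hnormal : S.IsNormal := fun X Y hX hY x ↦ by
    obtain ⟨e, he⟩ := hnf x
    rw [hchar.N_eq hX hY]
    simp only [S, hξe x e he]
    exact he.normalFormIn.contactEndo_normal hr hl hs (X x) (Y x)
  have hclosed : ∀ X Y Z : Π x : M, TangentSpace (𝓡 5) x,
      IsSmoothField X → IsSmoothField Y → IsSmoothField Z → ∀ x, S.dF X Y Z x = 0 :=
    fun X Y Z hX hY hZ x ↦ by
      obtain ⟨e, he⟩ := hnf x
      rw [hchar.dF_eq hX hY hZ]
      simp only [S, hξe x e he]
      exact he.normalFormIn.contactEndo_closed hr hl hs (X x) (Y x) (Z x)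
  -- In an adapted basis `dη` is `-(ϱ e₀₁ + λ e₂₃)` and `F` is `-(e₀₁ + e₂₃)`; comparison at a
  -- single point suffices, the constants being global.
  have hα : ∀ α : ℝ, S.IsAlphaSasakian α ↔ rho = α ∧ lam = α := by
    refine fun α ↦ ⟨fun h ↦ ?_, fun h ↦ ⟨hnormal, fun X Y hX hY x ↦ ?_⟩⟩
    · obtain ⟨x⟩ : Nonempty M := inferInstance
      obtain ⟨e, he⟩ := hnf x
      refine (he.normalFormIn.inner_xi_eq_iff hr hl hs α).mp fun u v ↦ ?_
      obtain ⟨X, hX, rfl⟩ := exists_smoothField_apply_eq x u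
      obtain ⟨Y, hY, rfl⟩ := exists_smoothField_apply_eq x v
      have h1 := h.2 X Y hX hY x
      rw [hchar.dη_eq hX hY] at h1
      simp only [MetricAlmostContactStructure.F, S, hξe x e he] at h1
      exact h1
    · obtain ⟨e, he⟩ := hnf x
      rw [hchar.dη_eq hX hY]
      simp only [MetricAlmostContactStructure.F, S, hξe x e he]
      exact (he.normalFormIn.inner_xi_eq_iff hr hl hs α).mpr h (X x) (Y x)
  refine ⟨S, fun x ↦ rfl, fun x e he X Y ↦ ?_, ⟨hnormal, hclosed⟩, hchar,
    fun cov' h' Y hY x v ↦ hchar.cov_eq h' hY x v, ?_, fun h1 h2 ↦ ?_⟩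
  · simp only [MetricAlmostContactStructure.F, S, hξe x e he]
    exact he.normalFormIn.inner_contactEndo hr hl hs X Y
  · simp only [hα]
    exact ⟨fun ⟨α, h1, h2⟩ ↦ h2.trans h1.symm, fun h ↦ ⟨rho, rfl, h⟩⟩
  · exact (hα 2).mpr ⟨h2, h1.trans h2⟩

end
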